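/- Let $h = 2\pi^2$, and for integers $N_t \ge 1$ let $T = \sqrt{N_t h/4} = \pi\sqrt{N_t/2}$. For $x\in(0,1]$ put $$f(u,x) = \frac{x}{\pi}\,\frac{1}{\sqrt u}\,\frac{e^{\sqrt u - T}}{e^{2(\sqrt u - T)}+x}$$ (principal branch of $\sqrt u$) and $\delta(u) = \mu(u) + \frac{i}{2}\cot\left(\frac{\pi u}{h}\right)$, where $\mu(u) = -\frac12$ if $\operatorname{Im} u \ge 0$ and $\mu(u) = \frac12$ if $\operatorname{Im} u < 0$. Assume the following (conjectured) bound: for every integer $N_t \ge 1$ and every $x \in [e^{4-2T}, 1]$, $$\left|\int_\Gamma f(u,x)\,\delta(u)\,du\right| < 12\, e^{-T},$$ where $\Gamma$ is the positively oriented boundary of the rectangle $[1, 4T^2+1]\times[-ai, ai]$ with $a = 2\pi\left(T + \frac12\log x\right)$. For $C \ge 1$, $\sigma = 2\sqrt2\,\pi$ and $N_1 \ge 1$ consider the tapered lightning poles $$p_j = -C\exp\left(-\sigma(\sqrt{N_1}-\sqrt j)\right), \qquad 1\le j\le N_1,$$ and call $$r(x) = \sum_{j=1}^{N_1}\frac{a_j}{x-p_j}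 + b(x),$$ with real $a_j \neq 0$ and a real polynomial $b$ of degree $N_2$ (for $N_2=0$: a constant, possibly zero), a lightning + polynomial approximant of type $(N_1,N_2)$; its total degree is $N = N_1+N_2$. **Theorem.** For every $C \ge 1$ there are constants $M, K$ such that: 1. for every $N_1 \ge 1$ there are an $N_2 \le M\sqrt{N_1}$ and a lightning + polynomial approximant $r$ of type $(N_1,N_2)$ such that, with $N = N_1+N_2$, $$|r(x)-\sqrt x\,| \le K e^{-\pi\sqrt{2N}} \qquad\text{for all } x\in[0,1];$$ 2. every total degree occurs: for every $N \ge 1$ there are $N_1 \ge 1$ and $N_2 \le M\sqrt{N_1}$ with $N_1+N_2 = N$ and a lightning + polynomial approximant $r$ of type $(N_1,N_2)$ satisfying the same estimate. In particular, $|r(x)-\sqrt x\,| = O(e^{-\pi\sqrt{2N}})$ uniformly for $x\in[0,1]$, with $N_2 = O(\sqrt{N_1})$, as $N\to\infty$. -/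

import Mathlib

namespace LightningPoly

noncomputable section

/-! ### Lightning + polynomial approximants -/

/-- The `j`-th of the `N₁` tapered, exponentially clustered poles on `[-C, 0)` with clustering
parameter `σ`: `p_j = -C exp (-σ (√N₁ - √j))`, for `1 ≤ j ≤ N₁`. -/
def taperedPole (C σ : ℝ) (N₁ j : ℕ) : ℝ :=
  -C * Real.exp (-σ * (√(N₁ : ℝ) - √(j : ℝ)))

/-- The rational function `r(x) = ∑_{j=1}^{N₁} a_j / (x - p_j) + b(x)` whose finite poles are the
tapered poles and whose polynomial part is `b`. -/
def approximant (C σ : ℝ) (N₁ : ℕ) (a : ℕ → ℝ) (b : Polynomial ℝ) (x : ℝ) : ℝ :=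
  ∑ j ∈ Finset.Icc 1 N₁, a j / (x - taperedPole C σ N₁ j) + b.eval x

/-- `√x` is approximated on `[0,1]` with uniform error at most `ε` by a lightning + polynomial
approximant with exactly `N₁` finite poles, the tapered ones, and a polynomial part of degree `N₂`
(so `N₂` poles at infinity, and total degree `N₁ + N₂`). -/
def ApproximatesSqrt (C σ : ℝ) (N₁ N₂ : ℕ) (ε : ℝ) : Prop :=
  ∃ (a : ℕ → ℝ) (b : Polynomial ℝ),
    (∀ j ∈ Finset.Icc 1 N₁, a j ≠ 0) ∧ b.natDegree = N₂ ∧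
      ∀ x ∈ Set.Icc (0 : ℝ) 1, |approximant C σ N₁ a b x - √x| ≤ ε

/-! ### The conjectured bound on a contour integral -/

/-- The step size `h = 2π²`. -/
def stepSize : ℝ := 2 * Real.pi ^ 2

/-- The truncation parameter `T = √(N_t h / 4)` for `N_t` quadrature points. -/
def truncation (Nt : ℕ) : ℝ := √((Nt : ℝ) * stepSize / 4)

/-- The integrand `f(u,x) = (x/π) (1/√u) e^{√u - T} / (e^{2(√u - T)} + x)`, with the principal
branch of `√u`. -/
def integrand (T x : ℝ) (u : ℂ) : ℂ :=
  ((x / Real.pi : ℝ) : ℂ) * (1 / u ^ (1 / 2 : ℂ)) *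
    (Complex.exp (u ^ (1 / 2 : ℂ) - T) /
      (Complex.exp (2 * (u ^ (1 / 2 : ℂ) - T)) + x))

/-- `μ(u) = -1/2` if `Im u ≥ 0`, and `μ(u) = 1/2` if `Im u < 0`. -/
def mu (u : ℂ) : ℂ := if 0 ≤ u.im then -(1 / 2) else 1 / 2

/-- `m(u) = -(i/2) cot (π u / h)`. -/
def m (u : ℂ) : ℂ :=
  -(Complex.I / 2) * Complex.cot ((Real.pi : ℂ) * u / (stepSize : ℂ))

/-- `δ(u) = μ(u) - m(u)`. -/
def delta (u : ℂ) : ℂ := mu u - m u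

/-- The integral of `g` over the positively oriented boundary of the rectangle
`[l, r] × [-a i, a i]`. -/
def rectIntegral (g : ℂ → ℂ) (l r a : ℝ) : ℂ :=
  (∫ s in l..r, g ((s : ℂ) + ((-a : ℝ) : ℂ) * Complex.I))
    + Complex.I * (∫ y in (-a)..a, g ((r : ℂ) + (y : ℂ) * Complex.I))
    - (∫ s in l..r, g ((s : ℂ) + (a : ℂ) * Complex.I))
    - Complex.I * (∫ y in (-a)..a, g ((l : ℂ) + (y : ℂ) * Complex.I))

/-- The conjectured bound `|∫_Γ f(u,x) δ(u) du| < 12 e^{-T}`, for every number `N_t ≥ 1` of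
quadrature points and every `x ∈ [e^{4-2T}, 1]`, where `T = √(N_t h / 4)` and `Γ` is the positively
oriented boundary of `[1, 4T² + 1] × [-a i, a i]` with `a = 2π (T + (log x)/2)`. -/
def ContourBound : Prop :=
  ∀ Nt : ℕ, 1 ≤ Nt → ∀ x ∈ Set.Icc (Real.exp (4 - 2 * truncation Nt)) 1,
    ‖rectIntegral (fun u => integrand (truncation Nt) x u * delta u)
        1 (4 * truncation Nt ^ 2 + 1)
        (2 * Real.pi * (truncation Nt + 1 / 2 * Real.log x))‖
      < 12 * Real.exp (-truncation Nt)

end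

end LightningPoly

/-!
The rational function comes from a quadrature rule. The substitution `v = e^{√u - T}` turns
`√x = (2x/π) ∫₀^∞ dv / (v² + x)` into an integral of `f(u, x)` over `u > 0`, up to tails of size
`O(e^{-T})`. The rule with nodes `h, 2h, …, N h`, where `h = 2π²`, gives a sum of multiples of
`x / (x - p_k)` with `p_k = -e^{2(√(kh) - T)}`. When `N = 4 N₁` these `p_k` are exactly the tapered
poles with `C = 1` (for `k ≤ N₁`) and their continuation beyond `-1` (for `N₁ < k ≤ 4 N₁`), and
`T = π √(2 N₁)`.

For `x ≥ e^{4-2T}` the error of the rule is compared with the contour integral of `f δ`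
(`rectIntegral_eq_quadrature_error`). The residue theorem for simple poles in a rectangle is proved
first (`boxIntegral_eq_sum_residues`). It is applied to `f` on the two halves of the rectangle and
to `f` times the cotangent on the whole rectangle. The difference between the contour integral and
the quadrature error consists of the residues of `f δ` at the two poles of `f` inside, which are
`O(e^{-T})` because `δ` decays exponentially away from the real axis (`norm_delta_pole_le`). Hence
the assumed contour bound gives an error `O(e^{-T})`. For `x ≤ e^{4-2T}` both `√x` and the rule are
`O(e^{-T})` (`quadrature_le`).

It remains to replace the terms with `k > N₁` by a polynomial
(`approximatesSqrt_one_of_contourBound`). Their poles lie in `(-∞, -1]`, so a geometric series about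
`1/2` converges on `[0, 1]` with ratio `1/3`; the weights grow at most like `e^T`, and therefore any
degree `N₂ ≥ 3T` suffices. Rescaling `x` handles `C ≥ 1` (`ApproximatesSqrt.rescale`). Since
`N₂ = O(√N₁)`, passing from `e^{-π√(2N₁)}` to `e^{-π√(2N)}` costs only a constant factor, and the
freedom in `N₂` lets every large total degree be reached; the finitely many small ones are absorbed
into the constant (`approximatesSqrt_two`).
-/

namespace LightningPoly

open Complex Set Filter Topology MeasureTheory

/-! ### The residue theorem for simple poles in a rectangle -/

/-- The integral of `g` over the positively oriented boundary of `[l, r] × [b i, t i]`. The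
case `b = -t` is `rectIntegral`. -/
noncomputable def boxIntegral (g : ℂ → ℂ) (l r b t : ℝ) : ℂ :=
  (∫ s in l..r, g ((s : ℂ) + (b : ℂ) * I))
    + I * (∫ y in b..t, g ((r : ℂ) + (y : ℂ) * I))
    - (∫ s in l..r, g ((s : ℂ) + (t : ℂ) * I))
    - I * (∫ y in b..t, g ((l : ℂ) + (y : ℂ) * I))

/-- Integrability along each of the four sides of the rectangle `[l, r] × [b i, t i]`. -/
def BoxIntegrable (g : ℂ → ℂ) (l r b t : ℝ) : Prop :=
  IntervalIntegrable (fun s : ℝ => g ((s : ℂ) + (b : ℂ) * I)) volume l r ∧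
  IntervalIntegrable (fun y : ℝ => g ((r : ℂ) + (y : ℂ) * I)) volume b t ∧
  IntervalIntegrable (fun s : ℝ => g ((s : ℂ) + (t : ℂ) * I)) volume l r ∧
  IntervalIntegrable (fun y : ℝ => g ((l : ℂ) + (y : ℂ) * I)) volume b t

/-- The boundary of the rectangle `[l, r] × [b i, t i]`. -/
def boxBoundary (l r b t : ℝ) : Set ℂ :=
  {u | u.re ∈ Icc l r ∧ u.im ∈ Icc b t ∧ (u.re = l ∨ u.re = r ∨ u.im = b ∨ u.im = t)}

section sides

variable {l r b t : ℝ}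

lemma bottom_mem (hbt : b ≤ t) {s : ℝ} (hs : s ∈ Icc l r) :
    (s : ℂ) + (b : ℂ) * I ∈ boxBoundary l r b t := by
  simp [boxBoundary, hs.1, hs.2, hbt]

lemma top_mem (hbt : b ≤ t) {s : ℝ} (hs : s ∈ Icc l r) :
    (s : ℂ) + (t : ℂ) * I ∈ boxBoundary l r b t := by
  simp [boxBoundary, hs.1, hs.2, hbt]

lemma left_mem (hlr : l ≤ r) {y : ℝ} (hy : y ∈ Icc b t) :
    (l : ℂ) + (y : ℂ) * I ∈ boxBoundary l r b t := by
  simp [boxBoundary, hy.1, hy.2, hlr]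

lemma right_mem (hlr : l ≤ r) {y : ℝ} (hy : y ∈ Icc b t) :
    (r : ℂ) + (y : ℂ) * I ∈ boxBoundary l r b t := by
  simp [boxBoundary, hy.1, hy.2, hlr]

end sides

lemma intervalIntegrable_comp_segment {g : ℂ → ℂ} {γ : ℝ → ℂ} {a b : ℝ} (hab : a ≤ b)
    (hγ : Continuous γ) (hg : ∀ s ∈ Icc a b, ContinuousAt g (γ s)) :
    IntervalIntegrable (fun s => g (γ s)) volume a b := by
  apply ContinuousOn.intervalIntegrable
  rw [uIcc_of_le hab]
  exact fun s hs => ((hg s hs).comp hγ.continuousAt).continuousWithinAt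

lemma BoxIntegrable.of_continuousAt {g : ℂ → ℂ} {l r b t : ℝ} (hlr : l ≤ r) (hbt : b ≤ t)
    (hg : ∀ u ∈ boxBoundary l r b t, ContinuousAt g u) : BoxIntegrable g l r b t :=
  ⟨intervalIntegrable_comp_segment hlr (by fun_prop) fun _ hs => hg _ (bottom_mem hbt hs),
    intervalIntegrable_comp_segment hbt (by fun_prop) fun _ hs => hg _ (right_mem hlr hs),
    intervalIntegrable_comp_segment hlr (by fun_prop) fun _ hs => hg _ (top_mem hbt hs),
    intervalIntegrable_comp_segment hbt (by fun_prop) fun _ hs => hg _ (left_mem hlr hs)⟩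

lemma boxIntegral_add {f g : ℂ → ℂ} {l r b t : ℝ} (hf : BoxIntegrable f l r b t)
    (hg : BoxIntegrable g l r b t) :
    boxIntegral (fun u => f u + g u) l r b t = boxIntegral f l r b t + boxIntegral g l r b t := by
  obtain ⟨f1, f2, f3, f4⟩ := hf
  obtain ⟨g1, g2, g3, g4⟩ := hg
  simp only [boxIntegral]
  rw [intervalIntegral.integral_add f1 g1, intervalIntegral.integral_add f2 g2,
    intervalIntegral.integral_add f3 g3, intervalIntegral.integral_add f4 g4]
  ring

lemma boxIntegral_sub {f g : ℂ → ℂ} {l r b t : ℝ} (hf : BoxIntegrable f l r b t)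
    (hg : BoxIntegrable g l r b t) :
    boxIntegral (fun u => f u - g u) l r b t = boxIntegral f l r b t - boxIntegral g l r b t := by
  obtain ⟨f1, f2, f3, f4⟩ := hf
  obtain ⟨g1, g2, g3, g4⟩ := hg
  simp only [boxIntegral]
  rw [intervalIntegral.integral_sub f1 g1, intervalIntegral.integral_sub f2 g2,
    intervalIntegral.integral_sub f3 g3, intervalIntegral.integral_sub f4 g4]
  ring

lemma boxIntegral_const_mul (c : ℂ) (g : ℂ → ℂ) (l r b t : ℝ) :
    boxIntegral (fun u => c * g u) l r b t = c * boxIntegral g l r b t := by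
  simp only [boxIntegral, intervalIntegral.integral_const_mul]
  ring

lemma boxIntegral_congr {f g : ℂ → ℂ} {l r b t : ℝ} (hlr : l ≤ r) (hbt : b ≤ t)
    (h : EqOn f g (boxBoundary l r b t)) : boxIntegral f l r b t = boxIntegral g l r b t := by
  have h1 : (∫ s in l..r, f ((s : ℂ) + (b : ℂ) * I)) = ∫ s in l..r, g ((s : ℂ) + (b : ℂ) * I) :=
    intervalIntegral.integral_congr fun s hs => h (bottom_mem hbt (by rwa [uIcc_of_le hlr] at hs))
  have h2 : (∫ y in b..t, f ((r : ℂ) + (y : ℂ) * I)) = ∫ y in b..t, g ((r : ℂ) + (y : ℂ) * I) :=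
    intervalIntegral.integral_congr fun s hs => h (right_mem hlr (by rwa [uIcc_of_le hbt] at hs))
  have h3 : (∫ s in l..r, f ((s : ℂ) + (t : ℂ) * I)) = ∫ s in l..r, g ((s : ℂ) + (t : ℂ) * I) :=
    intervalIntegral.integral_congr fun s hs => h (top_mem hbt (by rwa [uIcc_of_le hlr] at hs))
  have h4 : (∫ y in b..t, f ((l : ℂ) + (y : ℂ) * I)) = ∫ y in b..t, g ((l : ℂ) + (y : ℂ) * I) :=
    intervalIntegral.integral_congr fun s hs => h (left_mem hlr (by rwa [uIcc_of_le hbt] at hs))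
  simp only [boxIntegral, h1, h2, h3, h4]

/-- Along the segment `s ↦ p + s v`, any rotation `ε` moving the segment off the branch cut gives
the primitive `log (ε (p + s v - z))` of `v / (p + s v - z)`. -/
lemma integral_segment_inv_sub (p v z ε : ℂ) {a b : ℝ}
    (hs : ∀ s ∈ uIcc a b, ε * (p + s * v - z) ∈ slitPlane) :
    v * ∫ s in a..b, (1 / (p + s * v - z)) =
      log (ε * (p + b * v - z)) - log (ε * (p + a * v - z)) := by
  rw [← intervalIntegral.integral_const_mul]
  have hne : ∀ s ∈ uIcc a b, ε * (p + (s : ℝ) * v - z) ≠ 0 := fun s h => slitPlane_ne_zero (hs s h)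
  refine intervalIntegral.integral_eq_sub_of_hasDerivAt
    (f := fun s : ℝ => log (ε * (p + s * v - z))) (fun s h => ?_) ?_
  · have hd : HasDerivAt (fun s : ℝ => ε * (p + s * v - z)) (ε * (1 * v)) s :=
      ((((hasDerivAt_id s).ofReal_comp.mul_const v).const_add p).sub_const z).const_mul ε
    refine (hd.clog_real (hs s h)).congr_deriv ?_
    have := hne s h
    rw [mul_div_mul_left _ _ (left_ne_zero_of_mul this)]
    ring
  · apply ContinuousOn.intervalIntegrable
    refine continuousOn_const.mul (continuousOn_const.div (by fun_prop) fun s h => ?_)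
    exact right_ne_zero_of_mul (hne s h)

lemma log_sub_log_neg_of_im_pos {w : ℂ} (hw : 0 < w.im) : log w - log (-w) = Real.pi * I := by
  simp only [log, norm_neg, arg_neg_eq_arg_sub_pi_of_im_pos hw]
  push_cast; ring

lemma log_sub_log_neg_of_im_neg {w : ℂ} (hw : w.im < 0) : log w - log (-w) = -(Real.pi * I) := by
  simp only [log, norm_neg, arg_neg_eq_arg_add_pi_of_im_neg hw]
  push_cast; ring

lemma boxIntegral_inv_sub {l r b t : ℝ} {z : ℂ} (hl : l < z.re) (hr : z.re < r) (hb : b < z.im)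
    (ht : z.im < t) : boxIntegral (fun u => 1 / (u - z)) l r b t = 2 * Real.pi * I := by
  have h1 := integral_segment_inv_sub (b * I) 1 z 1 (a := l) (b := r) fun s _ => by
    rw [mem_slitPlane_iff]; right; simp; linarith
  have h2 := integral_segment_inv_sub r I z 1 (a := b) (b := t) fun s _ => by
    rw [mem_slitPlane_iff]; left; simp; linarith
  have h3 := integral_segment_inv_sub (t * I) 1 z 1 (a := l) (b := r) fun s _ => by
    rw [mem_slitPlane_iff]; right; simp; linarith
  -- the left side crosses the cut of `log (u - z)`, so `log (-(u - z))` is used there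
  have h4 := integral_segment_inv_sub l I z (-1) (a := b) (b := t) fun s _ => by
    rw [mem_slitPlane_iff]; left; simp; linarith
  have e1 : (∫ s in l..r, (1 / ((s : ℂ) + (b : ℂ) * I - z))) =
      log (r + b * I - z) - log (l + b * I - z) := by
    rw [one_mul] at h1
    simpa only [mul_one, one_mul, add_comm (((b : ℂ)) * I)] using h1
  have e3 : (∫ s in l..r, (1 / ((s : ℂ) + (t : ℂ) * I - z))) =
      log (r + t * I - z) - log (l + t * I - z) := by
    rw [one_mul] at h3
    simpa only [mul_one, one_mul, add_comm (((t : ℂ)) * I)] using h3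
  have p1 := log_sub_log_neg_of_im_pos (w := (l + t * I - z)) (by simp; linarith)
  have p2 := log_sub_log_neg_of_im_neg (w := (l + b * I - z)) (by simp; linarith)
  simp only [boxIntegral]
  rw [h2, h4, e1, e3]
  simp only [one_mul, neg_one_mul]
  linear_combination p1 - p2

lemma boxIntegral_eq_zero_of_differentiableOn {F : ℂ → ℂ} {l r b t : ℝ} (hlr : l ≤ r) (hbt : b ≤ t)
    (hF : ∀ u : ℂ, u.re ∈ Icc l r → u.im ∈ Icc b t → DifferentiableAt ℂ F u) :
    boxIntegral F l r b t = 0 := by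
  have h := Complex.integral_boundary_rect_eq_zero_of_differentiableOn F (l + b * I) (r + t * I) ?_
  · simp only [smul_eq_mul, add_re, ofReal_re, mul_re, I_re, mul_zero, ofReal_im, I_im,
      mul_one, sub_self, add_zero, add_im, mul_im, zero_add] at h
    rw [boxIntegral, ← h]; ring
  · intro u hu
    simp only [mem_reProdIm, add_re, ofReal_re, mul_re, I_re, mul_zero, ofReal_im, I_im,
      mul_one, sub_self, add_zero, add_im, mul_im, zero_add, uIcc_of_le hlr, uIcc_of_le hbt] at hu
    exact (hF u hu.1 hu.2).differentiableWithinAt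

lemma sub_ne_zero_of_boundary {l r b t : ℝ} {z : ℂ} (hl : l < z.re) (hr : z.re < r) (hb : b < z.im)
    (ht : z.im < t) {u : ℂ} (hu : u ∈ boxBoundary l r b t) : u ≠ z := by
  rintro rfl
  rcases hu.2.2 with h | h | h | h <;> linarith

/-- The residue theorem for a function with finitely many simple poles in the open rectangle.
The residue at `z` is given as the limit of `(u - z) F u`. A pole `z` is removed by replacing
`F` with the difference quotient at `z` of `(u - z) F u`, which is holomorphic at `z`. -/
theorem boxIntegral_eq_sum_residues {l r b t : ℝ} (hlr : l ≤ r) (hbt : b ≤ t) (S : Finset ℂ)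
    (c : ℂ → ℂ)
    (hS : ∀ z ∈ S, (l < z.re ∧ z.re < r) ∧ (b < z.im ∧ z.im < t)) (F : ℂ → ℂ)
    (hF : ∀ u : ℂ, u.re ∈ Icc l r → u.im ∈ Icc b t → u ∉ S → DifferentiableAt ℂ F u)
    (hres : ∀ z ∈ S, Tendsto (fun u => (u - z) * F u) (𝓝[≠] z) (𝓝 (c z))) :
    boxIntegral F l r b t = 2 * Real.pi * I * ∑ z ∈ S, c z := by
  classical
  induction S using Finset.induction_on generalizing F with
  | empty =>
    rw [boxIntegral_eq_zero_of_differentiableOn hlr hbt fun u h1 h2 => hF u h1 h2 (by simp)]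
    simp
  | insert z S hz ih =>
    obtain ⟨⟨hl, hr⟩, hb, ht⟩ := hS z (by simp)
    set H : ℂ → ℂ := Function.update (fun u => (u - z) * F u) z (c z) with hH
    have hHz : H z = c z := by simp [hH]
    have hHne : ∀ u, u ≠ z → H u = (u - z) * F u := fun u hu => by simp [hH, hu]
    have hHcont : ContinuousAt H z := by
      rw [hH, continuousAt_update_same]; exact hres z (by simp)
    have hHev : ∀ u, u ≠ z → H =ᶠ[𝓝 u] fun u => (u - z) * F u := fun u hu => by
      filter_upwards [isOpen_ne.mem_nhds hu] with w hw using hHne w hw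
    have hnear : ∀ᶠ u in 𝓝[≠] z, DifferentiableAt ℂ H u := by
      have o1 : ∀ᶠ u : ℂ in 𝓝 z, l < u.re ∧ u.re < r ∧ b < u.im ∧ u.im < t := by
        refine ((continuous_re.tendsto z).eventually_const_lt hl).and
          (((continuous_re.tendsto z).eventually_lt_const hr).and
          (((continuous_im.tendsto z).eventually_const_lt hb).and
          ((continuous_im.tendsto z).eventually_lt_const ht)))
      have o2 : ∀ᶠ u : ℂ in 𝓝 z, u ∉ S :=
        (S.finite_toSet.isClosed.isOpen_compl).mem_nhds (by simpa using hz)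
      filter_upwards [nhdsWithin_le_nhds o1, nhdsWithin_le_nhds o2, self_mem_nhdsWithin]
        with u h1 h2 h3
      have h3' : u ≠ z := h3
      refine DifferentiableAt.congr_of_eventuallyEq ?_ (hHev u h3')
      exact (differentiableAt_id.sub_const z).mul
        (hF u ⟨h1.1.le, h1.2.1.le⟩ ⟨h1.2.2.1.le, h1.2.2.2.le⟩ (by simp [h3', h2]))
    have hHan : AnalyticAt ℂ H z :=
      analyticAt_of_differentiable_on_punctured_nhds_of_continuousAt hnear hHcont
    have hGne : ∀ u, u ≠ z → dslope H z u = F u - c z / (u - z) := fun u hu => by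
      have : u - z ≠ 0 := sub_ne_zero.2 hu
      rw [dslope_of_ne _ hu, slope_def_field, hHne u hu, hHz]
      field_simp
    have hGz : DifferentiableAt ℂ (dslope H z) z := by
      have hev : ∀ᶠ u in 𝓝 z, DifferentiableAt ℂ H u :=
        hHan.eventually_analyticAt.mono fun u hu => hu.differentiableAt
      have hs : {u | DifferentiableAt ℂ H u} ∈ 𝓝 z := hev
      exact ((Complex.differentiableOn_dslope hs).2
        fun u hu => DifferentiableAt.differentiableWithinAt hu).differentiableAt hs
    have hinv : ∀ u, u ≠ z → DifferentiableAt ℂ (fun u => c z / (u - z)) u := fun u hu => by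
      have : u - z ≠ 0 := sub_ne_zero.2 hu
      fun_prop (disch := assumption)
    have hGev : ∀ u, u ≠ z → dslope H z =ᶠ[𝓝 u] fun u => F u - c z / (u - z) := fun u hu => by
      filter_upwards [isOpen_ne.mem_nhds hu] with w hw using hGne w hw
    have hGd : ∀ u : ℂ, u.re ∈ Icc l r → u.im ∈ Icc b t → u ∉ S →
        DifferentiableAt ℂ (dslope H z) u := fun u h1 h2 h3 => by
      rcases eq_or_ne u z with rfl | hu
      · exact hGz
      · exact ((hF u h1 h2 (by simp [hu, h3])).sub (hinv u hu)).congr_of_eventuallyEq (hGev u hu)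
    have key := ih (fun w hw => hS w (by simp [hw])) (dslope H z) hGd fun w hw => by
      have hwz : w ≠ z := fun h => hz (h ▸ hw)
      have t1 : Tendsto (fun u => (u - w) * (c z / (u - z))) (𝓝[≠] w) (𝓝 0) := by
        have : ContinuousAt (fun u => (u - w) * (c z / (u - z))) w :=
          (continuousAt_id.sub continuousAt_const).mul (hinv w hwz).continuousAt
        have h := this.tendsto.mono_left (nhdsWithin_le_nhds (s := {w}ᶜ))
        simpa using h
      have t2 := (hres w (by simp [hw])).sub t1
      rw [sub_zero] at t2
      refine t2.congr' ?_
      filter_upwards [nhdsWithin_le_nhds (hGev w hwz)] with u hu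
      rw [hu]; ring
    have hSb : ∀ u ∈ boxBoundary l r b t, u ∉ S := fun u hu hus => by
      obtain ⟨⟨a1, a2⟩, a3, a4⟩ := hS u (by simp [hus])
      exact sub_ne_zero_of_boundary a1 a2 a3 a4 hu rfl
    have hbne : ∀ u ∈ boxBoundary l r b t, u ≠ z := fun u hu =>
      sub_ne_zero_of_boundary hl hr hb ht hu
    have i1 : BoxIntegrable (dslope H z) l r b t := .of_continuousAt hlr hbt fun u hu =>
      (hGd u hu.1 hu.2.1 (hSb u hu)).continuousAt
    have i2 : BoxIntegrable (fun u => c z * (1 / (u - z))) l r b t :=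
      .of_continuousAt hlr hbt fun u hu => by
        simpa only [mul_one_div] using (hinv u (hbne u hu)).continuousAt
    rw [boxIntegral_congr (g := fun u => dslope H z u + c z * (1 / (u - z))) hlr hbt
      fun u hu => by simp only [hGne u (hbne u hu)]; ring,
      boxIntegral_add i1 i2, boxIntegral_const_mul, boxIntegral_inv_sub hl hr hb ht, key,
      Finset.sum_insert hz]
    ring

/-- A contour integral against `μ` splits along the real axis: half the integral over the lower
half of the rectangle minus half the one over the upper half, plus the integral over the real
segment, which the two halves traverse in opposite directions. -/
lemma boxIntegral_mul_mu {f : ℂ → ℂ} {l r a : ℝ} (hlr : l ≤ r) (ha : 0 < a)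
    (hf : ∀ u ∈ boxBoundary l r (-a) a, ContinuousAt f u) :
    BoxIntegrable (fun u => f u * mu u) l r (-a) a ∧
    boxIntegral (fun u => f u * mu u) l r (-a) a =
      (∫ s in l..r, f s) + 1 / 2 * boxIntegral f l r (-a) 0 - 1 / 2 * boxIntegral f l r 0 a := by
  have mneg : ∀ (p : ℝ) {y : ℝ}, y < 0 → mu (p + y * I) = 1 / 2 := fun p y hy => by
    simp [mu, hy]
  have mpos : ∀ (p : ℝ) {y : ℝ}, 0 ≤ y → mu (p + y * I) = -(1 / 2) := fun p y hy => by
    simp [mu, hy]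
  obtain ⟨f1, f2, f3, f4⟩ := BoxIntegrable.of_continuousAt hlr (by linarith) hf
  have vert : ∀ p : ℝ, IntervalIntegrable (fun y : ℝ => f ((p : ℂ) + (y : ℂ) * I)) volume (-a) a →
      IntervalIntegrable (fun y : ℝ => f ((p : ℂ) + (y : ℂ) * I) * mu ((p : ℂ) + (y : ℂ) * I))
        volume (-a) a ∧
      (∫ y in (-a)..a, f ((p : ℂ) + (y : ℂ) * I) * mu ((p : ℂ) + (y : ℂ) * I)) =
        1 / 2 * (∫ y in (-a)..0, f ((p : ℂ) + (y : ℂ) * I))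
        - 1 / 2 * ∫ y in (0 : ℝ)..a, f ((p : ℂ) + (y : ℂ) * I) := by
    intro p hp
    have hp1 : IntervalIntegrable (fun y : ℝ => f ((p : ℂ) + (y : ℂ) * I)) volume (-a) 0 :=
      hp.mono_set (by rw [uIcc_of_le (by linarith), uIcc_of_le (by linarith)]
                      exact Icc_subset_Icc le_rfl ha.le)
    have hp2 : IntervalIntegrable (fun y : ℝ => f ((p : ℂ) + (y : ℂ) * I)) volume 0 a :=
      hp.mono_set (by rw [uIcc_of_le (by linarith), uIcc_of_le (by linarith)]
                      exact Icc_subset_Icc (by linarith) le_rfl)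
    have e1 : EqOn (fun y : ℝ => f ((p : ℂ) + (y : ℂ) * I) * (1 / 2))
        (fun y : ℝ => f ((p : ℂ) + (y : ℂ) * I) * mu ((p : ℂ) + (y : ℂ) * I)) (uIoo (-a) 0) := by
      intro y hy
      rw [uIoo_of_le (by linarith)] at hy
      simp only [mneg p hy.2]
    have e2 : EqOn (fun y : ℝ => f ((p : ℂ) + (y : ℂ) * I) * (-(1 / 2)))
        (fun y : ℝ => f ((p : ℂ) + (y : ℂ) * I) * mu ((p : ℂ) + (y : ℂ) * I)) (uIoo 0 a) := by
      intro y hy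
      rw [uIoo_of_le ha.le] at hy
      simp only [mpos p hy.1.le]
    have q1 := (hp1.mul_const (1 / 2)).congr_uIoo e1
    have q2 := (hp2.mul_const (-(1 / 2))).congr_uIoo e2
    refine ⟨q1.trans q2, ?_⟩
    rw [← intervalIntegral.integral_add_adjacent_intervals q1 q2,
      ← intervalIntegral.integral_congr_uIoo e1, ← intervalIntegral.integral_congr_uIoo e2,
      intervalIntegral.integral_mul_const, intervalIntegral.integral_mul_const]
    ring
  have b1 : (fun s : ℝ => f ((s : ℂ) + ((-a : ℝ) : ℂ) * I) * mu ((s : ℂ) + ((-a : ℝ) : ℂ) * I)) =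
      fun s : ℝ => f ((s : ℂ) + ((-a : ℝ) : ℂ) * I) * (1 / 2) := by
    funext s; rw [mneg s (by linarith)]
  have b3 : (fun s : ℝ => f ((s : ℂ) + (a : ℂ) * I) * mu ((s : ℂ) + (a : ℂ) * I)) =
      fun s : ℝ => f ((s : ℂ) + (a : ℂ) * I) * (-(1 / 2)) := by
    funext s; rw [mpos s ha.le]
  obtain ⟨v2, w2⟩ := vert r f2
  obtain ⟨v4, w4⟩ := vert l f4
  refine ⟨⟨?_, v2, ?_, v4⟩, ?_⟩
  · simpa only [b1] using f1.mul_const (1 / 2)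
  · simpa only [b3] using f3.mul_const (-(1 / 2))
  · simp only [boxIntegral, w2, w4, b1, b3, intervalIntegral.integral_mul_const, ofReal_zero,
      zero_mul, add_zero]
    ring

/-! ### Poles and residues of the integrand -/

lemma stepSize_pos : 0 < stepSize := by unfold stepSize; positivity

lemma four_mul_truncation_sq (N : ℕ) : 4 * truncation N ^ 2 = N * stepSize := by
  have := stepSize_pos
  rw [truncation, Real.sq_sqrt (by positivity)]; ring

lemma cpow_half_sq (u : ℂ) : (u ^ (1 / 2 : ℂ)) ^ 2 = u := by
  simp

lemma sq_cpow_half {v : ℂ} (hv : 0 < v.re) : (v ^ 2) ^ (1 / 2 : ℂ) = v := by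
  rw [one_div]; exact Complex.sq_cpow_two_inv hv

lemma cpow_half_ne_zero {u : ℂ} (hu : 0 < u.re) : u ^ (1 / 2 : ℂ) ≠ 0 := by
  intro h
  have := cpow_half_sq u
  rw [h] at this
  simp [← this] at hu

lemma hasDerivAt_cpow_half {u : ℂ} (hu : 0 < u.re) :
    HasDerivAt (fun u : ℂ => u ^ (1 / 2 : ℂ)) (1 / (2 * u ^ (1 / 2 : ℂ))) u := by
  have h := (hasDerivAt_id u).cpow_const (c := (1 / 2 : ℂ)) (Or.inl hu)
  refine h.congr_deriv ?_
  have hne : u ≠ 0 := by rintro rfl; simp at hu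
  have h2 := cpow_half_ne_zero hu
  simp only [id, cpow_sub _ _ hne, cpow_one]
  field_simp
  rw [cpow_half_sq]

/-- The denominator of the integrand, whose zeros are the poles of the integrand in the right
half-plane. -/
noncomputable def denom (T x : ℝ) (u : ℂ) : ℂ := exp (2 * (u ^ (1 / 2 : ℂ) - T)) + x

lemma hasDerivAt_denom {T x : ℝ} {u : ℂ} (hu : 0 < u.re) :
    HasDerivAt (denom T x) (exp (2 * (u ^ (1 / 2 : ℂ) - T)) / u ^ (1 / 2 : ℂ)) u := by
  have h := ((((hasDerivAt_cpow_half hu).sub_const (T : ℂ)).const_mul 2).cexp).add_const (x : ℂ)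
  refine h.congr_deriv ?_
  have h2 := cpow_half_ne_zero hu
  field_simp

lemma differentiableAt_integrand {T x : ℝ} {u : ℂ} (hu : 0 < u.re) (hD : denom T x u ≠ 0) :
    DifferentiableAt ℂ (integrand T x) u := by
  have h1 := (hasDerivAt_cpow_half hu).differentiableAt
  have h2 : DifferentiableAt ℂ (fun u => exp (2 * (u ^ (1 / 2 : ℂ) - T)) + x) u :=
    (hasDerivAt_denom hu).differentiableAt
  have h3 : DifferentiableAt ℂ (fun u : ℂ => 1 / u ^ (1 / 2 : ℂ)) u :=
    (differentiableAt_const _).div h1 (cpow_half_ne_zero hu)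
  exact (h3.const_mul _).mul (((h1.sub_const _).cexp).div h2 hD)

/-- The pole `(L ± iπ/2)²` of the integrand, with `L = T + (log x)/2` and the sign `ε = ±1`. -/
noncomputable def pole (L ε : ℝ) : ℂ := ((L : ℂ) + (ε * (Real.pi / 2) : ℝ) * I) ^ 2

lemma pole_re (L ε : ℝ) (hε : ε ^ 2 = 1) : (pole L ε).re = L ^ 2 - Real.pi ^ 2 / 4 := by
  simp [pole, sq]
  linear_combination (Real.pi ^ 2 / 4) * hε

lemma pole_im (L ε : ℝ) : (pole L ε).im = ε * (Real.pi * L) := by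
  simp [pole, sq]; ring

lemma pole_cpow_half {L : ℝ} (ε : ℝ) (hL : 0 < L) :
    pole L ε ^ (1 / 2 : ℂ) = (L : ℂ) + (ε * (Real.pi / 2) : ℝ) * I :=
  sq_cpow_half (by simpa using hL)

lemma exp_pi_sign {ε : ℝ} (hε : ε = 1 ∨ ε = -1) : exp ((ε * Real.pi : ℝ) * I) = -1 := by
  rcases hε with rfl | rfl
  · simp
  · simp [Complex.exp_neg]

lemma two_mul_shift {x : ℝ} (T : ℝ) (hx : 0 < x) :
    (exp (2 * (((T + 1 / 2 * Real.log x : ℝ) : ℂ) - T))) = x := by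
  rw [show (2 * (((T + 1 / 2 * Real.log x : ℝ) : ℂ) - T)) = ((Real.log x : ℝ) : ℂ) by
    push_cast; ring, ← ofReal_exp, Real.exp_log hx]

lemma denom_pole {T x ε : ℝ} (hx : 0 < x) (hL : 0 < T + 1 / 2 * Real.log x)
    (hε : ε = 1 ∨ ε = -1) : denom T x (pole (T + 1 / 2 * Real.log x) ε) = 0 := by
  rw [denom, pole_cpow_half _ hL,
    show 2 * (((T + 1 / 2 * Real.log x : ℝ) : ℂ) + (ε * (Real.pi / 2) : ℝ) * I - T) =
      2 * (((T + 1 / 2 * Real.log x : ℝ) : ℂ) - T) + (ε * Real.pi : ℝ) * I by push_cast; ring,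
    exp_add, exp_pi_sign hε, two_mul_shift T hx]
  ring

/-- Within the strip `|Im u| ≤ 2πL` the integrand has no poles other than the pair
`(L ± iπ/2)²`: the remaining ones have `|Im u| ≥ 3πL`. -/
lemma eq_pole_of_denom_eq_zero {T x : ℝ} (hx : 0 < x) (hL : 0 < T + 1 / 2 * Real.log x) {u : ℂ}
    (him : |u.im| ≤ 2 * Real.pi * (T + 1 / 2 * Real.log x)) (hD : denom T x u = 0) :
    u = pole (T + 1 / 2 * Real.log x) 1 ∨ u = pole (T + 1 / 2 * Real.log x) (-1) := by
  set L := T + 1 / 2 * Real.log x with hLdef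
  set w := u ^ (1 / 2 : ℂ) with hw
  have hwu : w ^ 2 = u := cpow_half_sq u
  have h1 : exp (2 * (w - T)) = exp (2 * ((L : ℂ) - T) + Real.pi * I) := by
    rw [exp_add, two_mul_shift T hx, exp_pi_mul_I]
    rw [denom] at hD
    linear_combination hD
  obtain ⟨n, hn⟩ := exp_eq_exp_iff_exists_int.1 h1
  have hw2 : w = (L : ℂ) + ((1 + 2 * n) * (Real.pi / 2) : ℝ) * I := by
    push_cast
    linear_combination hn / 2
  have hu_im : u.im = (1 + 2 * n) * (Real.pi * L) := by
    rw [← hwu, hw2]; simp [sq]; ring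
  have hpL : 0 < Real.pi * L := mul_pos Real.pi_pos hL
  rw [hu_im, abs_mul, abs_of_pos hpL,
    show 2 * Real.pi * L = 2 * (Real.pi * L) by ring] at him
  have h2 : |((1 + 2 * n : ℤ) : ℝ)| ≤ 2 := by
    push_cast
    exact le_of_mul_le_mul_right him hpL
  have h3 : |1 + 2 * n| ≤ 2 := by exact_mod_cast h2
  rw [abs_le] at h3
  have h4 : n = 0 ∨ n = -1 := by omega
  rcases h4 with rfl | rfl
  · left
    rw [← hwu, hw2, pole]; simp
  · right
    rw [← hwu, hw2, pole]; norm_num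

lemma tendsto_sub_mul_div {A D : ℂ → ℂ} {D' z : ℂ} (hA : ContinuousAt A z) (hD : HasDerivAt D D' z)
    (hz : D z = 0) (hD' : D' ≠ 0) :
    Tendsto (fun u => (u - z) * (A u / D u)) (𝓝[≠] z) (𝓝 (A z / D')) := by
  have h := (hA.tendsto.mono_left nhdsWithin_le_nhds).div (hasDerivAt_iff_tendsto_slope.1 hD) hD'
  refine h.congr' ?_
  filter_upwards [self_mem_nhdsWithin] with u hu
  have : u - z ≠ 0 := sub_ne_zero.2 hu
  simp only [Pi.div_apply, slope_def_field, hz, sub_zero]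
  rw [div_div_eq_mul_div]; ring

/-- The residue of the integrand at a zero `z` of its denominator. -/
noncomputable def residue (T : ℝ) (z : ℂ) : ℂ := -exp (z ^ (1 / 2 : ℂ) - T) / Real.pi

lemma tendsto_sub_mul_integrand {T x : ℝ} (hx : x ≠ 0) {z : ℂ} (hz : 0 < z.re)
    (hD : denom T x z = 0) {g : ℂ → ℂ} (hg : ContinuousAt g z) :
    Tendsto (fun u => (u - z) * (integrand T x u * g u)) (𝓝[≠] z) (𝓝 (residue T z * g z)) := by
  have hw := cpow_half_ne_zero hz
  have hc := (hasDerivAt_cpow_half hz).continuousAt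
  have hA : ContinuousAt (fun u : ℂ => ((x / Real.pi : ℝ) : ℂ) * (1 / u ^ (1 / 2 : ℂ)) *
      exp (u ^ (1 / 2 : ℂ) - T) * g u) z :=
    ((continuousAt_const.mul (continuousAt_const.div hc hw)).mul
      ((hc.sub continuousAt_const).cexp)).mul hg
  have he : exp (2 * (z ^ (1 / 2 : ℂ) - T)) = -x := by
    rw [denom] at hD; linear_combination hD
  have hx' : (x : ℂ) ≠ 0 := by exact_mod_cast hx
  have h := tendsto_sub_mul_div hA (hasDerivAt_denom hz) hD
    (div_ne_zero (exp_ne_zero _) hw)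
  have hpi : (Real.pi : ℂ) ≠ 0 := by exact_mod_cast Real.pi_ne_zero
  convert h using 2
  · simp only [integrand, denom]; ring
  · rw [he, residue]; push_cast; field_simp

lemma norm_residue_pole {T x : ℝ} (ε : ℝ) (hx : 0 < x) (hL : 0 < T + 1 / 2 * Real.log x) :
    ‖residue T (pole (T + 1 / 2 * Real.log x) ε)‖ = √x / Real.pi := by
  rw [residue, pole_cpow_half _ hL, norm_div, norm_neg, norm_exp]
  have : (((T + 1 / 2 * Real.log x : ℝ) : ℂ) + (ε * (Real.pi / 2) : ℝ) * I - T).re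
      = Real.log x / 2 := by simp; ring
  rw [this, Real.exp_half, Real.exp_log hx]
  simp [abs_of_pos Real.pi_pos]

/-- The poles `k h` of `m` are simple with residue `-i h / (2π)`, so each node enters the residue
theorem with the weight `h` of the quadrature rule after multiplication by `2πi`. -/
lemma tendsto_sub_mul_mul_m {k : ℕ} {g : ℂ → ℂ} (hg : ContinuousAt g ((k * stepSize : ℝ) : ℂ)) :
    Tendsto (fun u => (u - ((k * stepSize : ℝ) : ℂ)) * (g u * m u))
      (𝓝[≠] ((k * stepSize : ℝ) : ℂ))
      (𝓝 (g ((k * stepSize : ℝ) : ℂ) * (-(I / 2) * (stepSize / Real.pi)))) := by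
  have hh : (stepSize : ℂ) ≠ 0 := by exact_mod_cast stepSize_pos.ne'
  have hpi : (Real.pi : ℂ) ≠ 0 := by exact_mod_cast Real.pi_ne_zero
  set z : ℂ := ((k * stepSize : ℝ) : ℂ) with hz
  have harg : (Real.pi : ℂ) * z / stepSize = k * Real.pi := by
    rw [hz]; push_cast; field_simp
  have hlin : HasDerivAt (fun u : ℂ => (Real.pi : ℂ) * u / stepSize)
      ((Real.pi : ℂ) / stepSize) z := by
    simpa using ((hasDerivAt_id z).const_mul (Real.pi : ℂ)).div_const (stepSize : ℂ)
  have hsin0 : sin ((Real.pi : ℂ) * z / stepSize) = 0 := by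
    rw [harg]; exact sin_nat_mul_pi k
  have hcos : cos ((Real.pi : ℂ) * z / stepSize) ≠ 0 := by
    intro h
    have := sin_sq_add_cos_sq ((Real.pi : ℂ) * z / stepSize)
    rw [h, hsin0] at this
    simp at this
  have hA : ContinuousAt (fun u => g u * (-(I / 2) * cos ((Real.pi : ℂ) * u / stepSize))) z :=
    hg.mul (by fun_prop)
  have h := tendsto_sub_mul_div hA hlin.csin hsin0 (mul_ne_zero hcos (div_ne_zero hpi hh))
  convert h using 2
  · simp only [m, cot]; ring
  · field_simp

lemma differentiableAt_m {u : ℂ} (hu : sin ((Real.pi : ℂ) * u / (stepSize : ℂ)) ≠ 0) :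
    DifferentiableAt ℂ m u := by
  unfold m
  simp only [cot]
  fun_prop (disch := assumption)

lemma eq_nat_mul_stepSize_of_sin_eq_zero {u : ℂ}
    (hu : sin ((Real.pi : ℂ) * u / (stepSize : ℂ)) = 0) :
    ∃ k : ℤ, u = ((k * stepSize : ℝ) : ℂ) := by
  obtain ⟨k, hk⟩ := Complex.sin_eq_zero_iff.1 hu
  have hh : (stepSize : ℂ) ≠ 0 := by exact_mod_cast stepSize_pos.ne'
  have hpi : (Real.pi : ℂ) ≠ 0 := by exact_mod_cast Real.pi_ne_zero
  refine ⟨k, ?_⟩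
  rw [div_eq_iff hh] at hk
  push_cast
  apply mul_left_cancel₀ hpi
  linear_combination hk

lemma delta_eq_inv_of_im_neg {z : ℂ} (hz : z.im < 0)
    (hq : exp (2 * I * ((Real.pi : ℂ) * z / (stepSize : ℂ))) ≠ 1) :
    delta z = 1 / (1 - exp (2 * I * ((Real.pi : ℂ) * z / (stepSize : ℂ)))) := by
  have h1 := sub_ne_zero.2 hq.symm
  rw [delta, m, mu, if_neg (not_le.2 hz), Complex.cot_eq_exp_ratio]
  generalize exp (2 * I * ((Real.pi : ℂ) * z / (stepSize : ℂ))) = q at h1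
  have hI := I_ne_zero
  field_simp
  ring

lemma delta_eq_div_of_im_nonneg {z : ℂ} (hz : 0 ≤ z.im)
    (hq : exp (2 * I * ((Real.pi : ℂ) * z / (stepSize : ℂ))) ≠ 1) :
    delta z = exp (2 * I * ((Real.pi : ℂ) * z / (stepSize : ℂ))) /
      (1 - exp (2 * I * ((Real.pi : ℂ) * z / (stepSize : ℂ)))) := by
  have h1 := sub_ne_zero.2 hq.symm
  rw [delta, m, mu, if_pos hz, Complex.cot_eq_exp_ratio]
  generalize exp (2 * I * ((Real.pi : ℂ) * z / (stepSize : ℂ))) = q at h1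
  have hI := I_ne_zero
  field_simp
  ring

/-- The factor `δ` is exponentially small at the poles of the integrand. -/
lemma norm_delta_pole_le {L ε : ℝ} (hL : 2 ≤ L) (hε : ε = 1 ∨ ε = -1) :
    ‖delta (pole L ε)‖ ≤ 2 * Real.exp (-L) := by
  have hpi := Real.pi_pos
  set q := exp (2 * I * ((Real.pi : ℂ) * pole L ε / (stepSize : ℂ))) with hq
  have hnq : ‖q‖ = Real.exp (-(ε * L)) := by
    rw [hq, norm_exp]
    congr 1
    rw [show 2 * I * ((Real.pi : ℂ) * pole L ε / (stepSize : ℂ)) =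
      ((2 * Real.pi / stepSize : ℝ) : ℂ) * (I * pole L ε) by push_cast; ring, re_ofReal_mul]
    simp only [mul_re, I_re, I_im, zero_mul, one_mul, zero_sub, pole_im, stepSize]
    field_simp
  have hE : (3 : ℝ) ≤ Real.exp L := by
    have := Real.add_one_le_exp L; linarith
  have hEE : Real.exp (-L) = 1 / Real.exp L := by rw [Real.exp_neg, one_div]
  have hE' : Real.exp (-L) ≤ 1 / 3 := by
    rw [hEE]; gcongr
  have hone : ‖q‖ ≠ 1 := by
    rw [hnq]
    rcases hε with rfl | rfl
    · rw [one_mul]; linarith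
    · rw [neg_one_mul, neg_neg]; linarith
  have hq1 : q ≠ 1 := fun h => hone (by simp [h])
  rcases hε with rfl | rfl
  · rw [one_mul] at hnq
    have him : 0 ≤ (pole L 1).im := by rw [pole_im]; positivity
    rw [delta_eq_div_of_im_nonneg him hq1, ← hq, norm_div, hnq]
    have h1 : 1 - Real.exp (-L) ≤ ‖1 - q‖ := by
      have := norm_sub_norm_le (1 : ℂ) q
      rwa [norm_one, hnq] at this
    rw [div_le_iff₀ (by linarith)]
    nlinarith [Real.exp_pos (-L)]
  · rw [neg_one_mul, neg_neg] at hnq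
    have him : (pole L (-1)).im < 0 := by rw [pole_im]; nlinarith
    rw [delta_eq_inv_of_im_neg him hq1, ← hq, norm_div, norm_one]
    have h1 : Real.exp L - 1 ≤ ‖1 - q‖ := by
      have := norm_sub_norm_le q (1 : ℂ)
      rwa [norm_one, hnq, norm_sub_rev] at this
    rw [hEE, div_le_iff₀ (by linarith)]
    rw [mul_one_div, div_mul_eq_mul_div, le_div_iff₀ (by linarith)]
    linarith

/-! ### The contour integral as a quadrature error -/

/-- The integrand on the positive real axis, as a real function. -/
noncomputable def realIntegrand (T x s : ℝ) : ℝ :=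
  x / Real.pi * (1 / √s) * (Real.exp (√s - T) / (Real.exp (2 * (√s - T)) + x))

lemma integrand_ofReal (T x : ℝ) {s : ℝ} (hs : 0 ≤ s) :
    integrand T x s = (realIntegrand T x s : ℂ) := by
  have h : (s : ℂ) ^ (1 / 2 : ℂ) = ((√s : ℝ) : ℂ) := by
    rw [Real.sqrt_eq_rpow, ofReal_cpow hs]; norm_num
  rw [integrand, realIntegrand, h]
  push_cast
  ring

/-- The integral of `f(·, x) δ` over the contour is the error of the rule with nodes `h, 2h, …, N h`
for the integral of `f(·, x)` over `[1, 4T² + 1]`, plus the contributions of the two enclosed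
poles of `f(·, x)`. -/
theorem rectIntegral_eq_quadrature_error {N : ℕ} {x : ℝ} (hx : 0 < x) (hx1 : x ≤ 1)
    (hL : 2 ≤ truncation N + 1 / 2 * Real.log x) :
    rectIntegral (fun u => integrand (truncation N) x u * delta u) 1 (4 * truncation N ^ 2 + 1)
        (2 * Real.pi * (truncation N + 1 / 2 * Real.log x)) =
      (∫ s in (1 : ℝ)..(4 * truncation N ^ 2 + 1), integrand (truncation N) x s)
      - ((stepSize * ∑ k ∈ Finset.Icc 1 N, realIntegrand (truncation N) x (k * stepSize) : ℝ) : ℂ)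
      + 2 * Real.pi * I *
        (residue (truncation N) (pole (truncation N + 1 / 2 * Real.log x) 1)
            * delta (pole (truncation N + 1 / 2 * Real.log x) 1)
          + residue (truncation N) (pole (truncation N + 1 / 2 * Real.log x) (-1))
            * delta (pole (truncation N + 1 / 2 * Real.log x) (-1))) := by
  classical
  have hlog : Real.log x ≤ 0 := Real.log_nonpos hx.le hx1
  have hrN : 4 * truncation N ^ 2 + 1 = N * stepSize + 1 := by rw [four_mul_truncation_sq]
  have hD1 := denom_pole (T := truncation N) (ε := 1) hx (by linarith) (Or.inl rfl)
  have hD2 := denom_pole (T := truncation N) (ε := -1) hx (by linarith) (Or.inr rfl)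
  have hpole := fun (u : ℂ) => eq_pole_of_denom_eq_zero (T := truncation N) (u := u) hx
    (by linarith)
  set T := truncation N with hT
  set L := T + 1 / 2 * Real.log x with hLdef
  set a := 2 * Real.pi * L with ha
  set r := 4 * T ^ 2 + 1 with hr
  set zp := pole L 1 with hzp
  set zm := pole L (-1) with hzm
  have hLT : L ≤ T := by linarith
  have hpi := Real.pi_pos
  have hpi3 := Real.pi_gt_three
  have hpi4 := Real.pi_lt_d2
  have hh1 : 1 < stepSize := by unfold stepSize; nlinarith
  have hpL : 0 < Real.pi * L := by nlinarith
  have ha0 : 0 < a := by rw [ha]; nlinarith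
  have hlr : (1 : ℝ) ≤ r := by rw [hr]; nlinarith [sq_nonneg T]
  have hre1 : zp.re = L ^ 2 - Real.pi ^ 2 / 4 := pole_re L 1 (by norm_num)
  have hre2 : zm.re = L ^ 2 - Real.pi ^ 2 / 4 := pole_re L (-1) (by norm_num)
  have him1 : zp.im = Real.pi * L := by rw [hzp, pole_im, one_mul]
  have him2 : zm.im = -(Real.pi * L) := by rw [hzm, pole_im, neg_one_mul]
  have hlo : 1 < L ^ 2 - Real.pi ^ 2 / 4 := by nlinarith
  have hhi : L ^ 2 - Real.pi ^ 2 / 4 < r := by rw [hr]; nlinarith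
  -- holomorphy of the two factors off their poles
  have hFd : ∀ u : ℂ, 1 ≤ u.re → |u.im| ≤ a → u ≠ zp → u ≠ zm →
      DifferentiableAt ℂ (integrand T x) u := fun u h1 h2 h3 h4 =>
    differentiableAt_integrand (by linarith) fun h => (hpole u h2 h).elim h3 h4
  have hmd : ∀ u : ℂ, (∀ k : ℤ, u ≠ ((k * stepSize : ℝ) : ℂ)) → DifferentiableAt ℂ m u :=
    fun u hu => differentiableAt_m fun h => by
      obtain ⟨k, hk⟩ := eq_nat_mul_stepSize_of_sin_eq_zero h
      exact hu k hk
  have hmim : ∀ u : ℂ, u.im ≠ 0 → DifferentiableAt ℂ m u := fun u hu => hmd u fun k hk => by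
    rw [hk] at hu
    exact hu (ofReal_im _)
  have hpm1 : DifferentiableAt ℂ m zp := hmim _ (by rw [him1]; exact hpL.ne')
  have hpm2 : DifferentiableAt ℂ m zm := hmim _ (by rw [him2]; exact (neg_neg_of_pos hpL).ne)
  have hres1 : ∀ {g : ℂ → ℂ}, ContinuousAt g zp →
      Tendsto (fun u => (u - zp) * (integrand T x u * g u)) (𝓝[≠] zp) (𝓝 (residue T zp * g zp)) :=
    fun hg => tendsto_sub_mul_integrand hx.ne' (by linarith) hD1 hg
  have hres2 : ∀ {g : ℂ → ℂ}, ContinuousAt g zm →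
      Tendsto (fun u => (u - zm) * (integrand T x u * g u)) (𝓝[≠] zm) (𝓝 (residue T zm * g zm)) :=
    fun hg => tendsto_sub_mul_integrand hx.ne' (by linarith) hD2 hg
  -- the two halves of the contour
  have hlower : boxIntegral (integrand T x) 1 r (-a) 0 = 2 * Real.pi * I * residue T zm := by
    have h := boxIntegral_eq_sum_residues (b := -a) (t := 0) hlr (by linarith) {zm}
      (fun z => residue T z) (by
        intro z hz
        rw [Finset.mem_singleton.1 hz, hre2, him2]
        exact ⟨⟨hlo, hhi⟩, by linarith, by linarith⟩) (integrand T x)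
      (fun u h1 h2 h3 => hFd u h1.1 (abs_le.2 ⟨h2.1, by linarith [h2.2]⟩)
        (fun h => by rw [h, him1] at h2; linarith [h2.2]) (by simpa using h3))
      (by
        intro z hz
        rw [Finset.mem_singleton.1 hz]
        simpa using hres2 (g := fun _ => 1) continuousAt_const)
    rw [h, Finset.sum_singleton]
  have hupper : boxIntegral (integrand T x) 1 r 0 a = 2 * Real.pi * I * residue T zp := by
    have h := boxIntegral_eq_sum_residues (b := 0) (t := a) hlr (by linarith) {zp}
      (fun z => residue T z) (by
        intro z hz
        rw [Finset.mem_singleton.1 hz, hre1, him1]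
        exact ⟨⟨hlo, hhi⟩, by linarith, by linarith⟩) (integrand T x)
      (fun u h1 h2 h3 => hFd u h1.1 (abs_le.2 ⟨by linarith [h2.1], h2.2⟩) (by simpa using h3)
        (fun h => by rw [h, him2] at h2; linarith [h2.1]))
      (by
        intro z hz
        rw [Finset.mem_singleton.1 hz]
        simpa using hres1 (g := fun _ => 1) continuousAt_const)
    rw [h, Finset.sum_singleton]
  -- the product with `m`, whose poles in the box are the quadrature nodes
  set node : ℕ → ℂ := fun k => ((k * stepSize : ℝ) : ℂ) with hnode
  set S : Finset ℂ := insert zp (insert zm ((Finset.Icc 1 N).image node)) with hS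
  have hnode_im : ∀ k, (node k).im = 0 := fun k => ofReal_im _
  have hnode_re : ∀ k, (node k).re = k * stepSize := fun k => ofReal_re _
  set c : ℂ → ℂ := fun z => if z.im = 0 then integrand T x z * (-(I / 2) * (stepSize / Real.pi))
    else residue T z * m z with hc
  have hSbox : ∀ z ∈ S, (1 < z.re ∧ z.re < r) ∧ (-a < z.im ∧ z.im < a) := by
    intro z hz
    simp only [hS, Finset.mem_insert, Finset.mem_image, Finset.mem_Icc] at hz
    rcases hz with rfl | rfl | ⟨k, ⟨hk1, hkN⟩, rfl⟩
    · rw [hre1, him1]; exact ⟨⟨hlo, hhi⟩, by linarith, by linarith⟩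
    · rw [hre2, him2]; exact ⟨⟨hlo, hhi⟩, by linarith, by linarith⟩
    · rw [hnode_re, hnode_im, hrN]
      have k1 : (1 : ℝ) ≤ k := by exact_mod_cast hk1
      have k2 : (k : ℝ) ≤ N := by exact_mod_cast hkN
      exact ⟨⟨by nlinarith, by nlinarith⟩, by linarith, ha0⟩
  have hFm : ∀ u : ℂ, u.re ∈ Icc 1 r → u.im ∈ Icc (-a) a → u ∉ S →
      DifferentiableAt ℂ (fun u => integrand T x u * m u) u := by
    intro u h1 h2 h3
    simp only [hS, Finset.mem_insert, Finset.mem_image, Finset.mem_Icc, not_or, not_exists,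
      not_and] at h3
    obtain ⟨n1, n2, n3⟩ := h3
    refine (hFd u h1.1 (abs_le.2 ⟨h2.1, h2.2⟩) n1 n2).mul (hmd u fun k hk => ?_)
    have hure : u.re = k * stepSize := by rw [hk, ofReal_re]
    rw [hure, hrN] at h1
    -- a node `k h` in the box has `1 ≤ k ≤ N` since `h > 1`
    have k1 : (0 : ℝ) < k := by
      by_contra hneg
      have : (k : ℝ) * stepSize ≤ 0 :=
        mul_nonpos_of_nonpos_of_nonneg (not_lt.1 hneg) (by linarith)
      linarith [h1.1]
    have k2 : (k : ℝ) < N + 1 := by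
      by_contra hge
      have : ((N : ℝ) + 1) * stepSize ≤ k * stepSize :=
        mul_le_mul_of_nonneg_right (not_lt.1 hge) (by linarith)
      linarith [h1.2]
    have k1' : 0 < k := by exact_mod_cast k1
    have k2' : k < N + 1 := by exact_mod_cast k2
    obtain ⟨j, rfl⟩ := Int.eq_ofNat_of_zero_le k1'.le
    exact n3 j ⟨by omega, by omega⟩ (by rw [hk, hnode]; simp)
  have hresS : ∀ z ∈ S, Tendsto (fun u => (u - z) * (integrand T x u * m u)) (𝓝[≠] z)
      (𝓝 (c z)) := by
    intro z hz
    simp only [hS, Finset.mem_insert, Finset.mem_image, Finset.mem_Icc] at hz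
    rcases hz with rfl | rfl | ⟨k, ⟨hk1, hkN⟩, rfl⟩
    · rw [hc]; simp only [him1, hpL.ne', if_false]
      exact hres1 hpm1.continuousAt
    · rw [hc]; simp only [him2, neg_eq_zero, hpL.ne', if_false]
      exact hres2 hpm2.continuousAt
    · rw [hc]; simp only [hnode_im, if_true]
      have k1 : (1 : ℝ) ≤ k := by exact_mod_cast hk1
      refine tendsto_sub_mul_mul_m (hFd _ ?_ ?_ ?_ ?_).continuousAt
      · rw [ofReal_re]; nlinarith
      · rw [ofReal_im, abs_zero]; exact ha0.le
      · intro h; have := congrArg Complex.im h; rw [ofReal_im, him1] at this; linarith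
      · intro h; have := congrArg Complex.im h; rw [ofReal_im, him2] at this; linarith
  have hFmInt := boxIntegral_eq_sum_residues hlr (by linarith) S c hSbox _ hFm hresS
  have hsum : ∑ z ∈ S, c z = residue T zp * m zp + (residue T zm * m zm +
      ∑ k ∈ Finset.Icc 1 N, (realIntegrand T x (k * stepSize) : ℂ) *
        (-(I / 2) * (stepSize / Real.pi))) := by
    have d1 : zm ∉ (Finset.Icc 1 N).image node := by
      simp only [Finset.mem_image, not_exists, not_and]
      intro k _ h; have := congrArg Complex.im h; rw [hnode_im, him2] at this; linarith
    have d2 : zp ∉ insert zm ((Finset.Icc 1 N).image node) := by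
      simp only [Finset.mem_insert, Finset.mem_image, not_or, not_exists, not_and]
      refine ⟨fun h => ?_, fun k _ h => ?_⟩
      · have := congrArg Complex.im h; rw [him1, him2] at this; linarith
      · have := congrArg Complex.im h; rw [hnode_im, him1] at this; linarith
    have inj : Set.InjOn node (Finset.Icc 1 N : Finset ℕ) := fun i _ j _ hij => by
      have := congrArg Complex.re hij
      rw [hnode_re, hnode_re] at this
      exact_mod_cast mul_right_cancel₀ stepSize_pos.ne' this
    rw [hS, Finset.sum_insert d2, Finset.sum_insert d1, Finset.sum_image inj]
    congr 1
    · simp only [hc, him1, hpL.ne', if_false]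
    congr 1
    · simp only [hc, him2, neg_eq_zero, hpL.ne', if_false]
    · refine Finset.sum_congr rfl fun k _ => ?_
      simp only [hc, hnode_im, if_true]
      rw [hnode, integrand_ofReal T x (mul_nonneg (Nat.cast_nonneg k) stepSize_pos.le)]
  have hSb : ∀ u ∈ boxBoundary 1 r (-a) a, u ∉ S := fun u hu hus => by
    obtain ⟨⟨a1, a2⟩, a3, a4⟩ := hSbox u hus
    exact sub_ne_zero_of_boundary a1 a2 a3 a4 hu rfl
  have hFb : ∀ u ∈ boxBoundary 1 r (-a) a, ContinuousAt (integrand T x) u := fun u hu => by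
    have h := hSb u hu
    simp only [hS, Finset.mem_insert, not_or] at h
    exact (hFd u hu.1.1 (abs_le.2 ⟨hu.2.1.1, hu.2.1.2⟩) h.1 h.2.1).continuousAt
  obtain ⟨hi1, hmuInt⟩ := boxIntegral_mul_mu hlr ha0 hFb
  have hi2 : BoxIntegrable (fun u => integrand T x u * m u) 1 r (-a) a :=
    .of_continuousAt hlr (by linarith) fun u hu => (hFm u hu.1 hu.2.1 (hSb u hu)).continuousAt
  have hsplit : rectIntegral (fun u => integrand T x u * delta u) 1 r a =
      boxIntegral (fun u => integrand T x u * mu u) 1 r (-a) a -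
        boxIntegral (fun u => integrand T x u * m u) 1 r (-a) a := by
    rw [← boxIntegral_sub hi1 hi2]
    simp only [delta, mul_sub]
    rfl
  rw [hsplit, hmuInt, hlower, hupper, hFmInt, hsum, ← Finset.sum_mul]
  have hmu1 : mu zp = -(1 / 2) := by simp [mu, him1, hpL.le]
  have hmu2 : mu zm = 1 / 2 := by simp [mu, him2, hpL]
  have hpiC : (Real.pi : ℂ) ≠ 0 := by exact_mod_cast Real.pi_ne_zero
  simp only [delta, hmu1, hmu2]
  rw [ofReal_mul, ofReal_sum]
  generalize ∑ k ∈ Finset.Icc 1 N, (realIntegrand T x (k * stepSize) : ℂ) = Q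
  field_simp
  linear_combination ((stepSize : ℂ) * Q) * I_sq

/-! ### The error of the truncated quadrature rule -/

/-- The substitution `v = e^{√s - T}` turns the integrand into `(2x/π) dv / (v² + x)`. -/
lemma integral_integrand (T : ℝ) {x R : ℝ} (hx : 0 < x) (hR : 1 ≤ R) :
    (∫ s in (1 : ℝ)..R, integrand T x s) =
      ((2 * √x / Real.pi * (Real.arctan (Real.exp (√R - T) / √x)
        - Real.arctan (Real.exp (1 - T) / √x)) : ℝ) : ℂ) := by
  have hsx : 0 < √x := Real.sqrt_pos.2 hx
  have h1 : (∫ s in (1 : ℝ)..R, integrand T x s) =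
      ∫ s in (1 : ℝ)..R, (realIntegrand T x s : ℂ) := by
    refine intervalIntegral.integral_congr fun s hs => ?_
    rw [uIcc_of_le hR] at hs
    exact integrand_ofReal T x (by linarith [hs.1])
  rw [h1, intervalIntegral.integral_ofReal]
  congr 1
  have hd : ∀ s ∈ uIcc 1 R, HasDerivAt
      (fun s => 2 * √x / Real.pi * Real.arctan (Real.exp (√s - T) / √x))
      (realIntegrand T x s) s := by
    intro s hs
    rw [uIcc_of_le hR] at hs
    have hs0 : 0 < s := by linarith [hs.1]
    have hss : 0 < √s := Real.sqrt_pos.2 hs0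
    have h := ((((Real.hasDerivAt_sqrt hs0.ne').sub_const T).exp.div_const (√x)).arctan).const_mul
      (2 * √x / Real.pi)
    refine h.congr_deriv ?_
    have hden : 0 < Real.exp (√s - T) ^ 2 + x := by positivity
    rw [realIntegrand, div_pow, Real.sq_sqrt hx.le,
      show Real.exp (2 * (√s - T)) = Real.exp (√s - T) ^ 2 by rw [← Real.exp_nat_mul]; norm_num]
    have hden' : 1 + Real.exp (√s - T) ^ 2 / x ≠ 0 := by positivity
    have hpi := Real.pi_ne_zero
    field_simp
    ring
  have hc : ContinuousOn (realIntegrand T x) (uIcc 1 R) := by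
    intro s hs
    rw [uIcc_of_le hR] at hs
    have hss : √s ≠ 0 := (Real.sqrt_pos.2 (by linarith [hs.1])).ne'
    have hden : Real.exp (2 * (√s - T)) + x ≠ 0 := by positivity
    unfold realIntegrand
    exact ContinuousAt.continuousWithinAt (by fun_prop (disch := assumption))
  rw [intervalIntegral.integral_eq_sub_of_hasDerivAt hd hc.intervalIntegrable, Real.sqrt_one]
  ring

lemma arctan_le_self {y : ℝ} (hy : 0 ≤ y) : Real.arctan y ≤ y := by
  have h0 := Real.arctan_nonneg.2 hy
  calc Real.arctan y ≤ Real.tan (Real.arctan y) :=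
        Real.le_tan h0 (Real.arctan_lt_pi_div_two y)
    _ = y := Real.tan_arctan y

/-- The parts of the full integral `√x = ∫₀^∞ (2x/π) dv / (v² + x)` missed by the truncation to
`e^{1-T} ≤ v ≤ e^{√R-T}` are `O(e^{-T})` when `√R ≥ 2T`. -/
lemma abs_sqrt_sub_truncated_integral_le {T x R : ℝ} (hx : 0 < x) (hx1 : x ≤ 1)
    (hR : 2 * T ≤ √R) :
    |√x - 2 * √x / Real.pi * (Real.arctan (Real.exp (√R - T) / √x)
        - Real.arctan (Real.exp (1 - T) / √x))| ≤ 3 * Real.exp (-T) := by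
  have hsx : 0 < √x := Real.sqrt_pos.2 hx
  have hsx1 : √x ≤ 1 := Real.sqrt_le_one.2 hx1
  have hpi := Real.pi_pos
  have hpi3 := Real.pi_gt_three
  set y := Real.exp (√R - T) / √x with hy
  set z := Real.exp (1 - T) / √x with hz
  have hy0 : 0 < y := by positivity
  have hz0 : 0 < z := by positivity
  have e1 : √x - 2 * √x / Real.pi * (Real.arctan y - Real.arctan z) =
      2 * √x / Real.pi * ((Real.pi / 2 - Real.arctan y) + Real.arctan z) := by
    field_simp; ring
  have hyy : Real.pi / 2 - Real.arctan y ≤ y⁻¹ := by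
    rw [← Real.arctan_inv_of_pos hy0]; exact arctan_le_self (by positivity)
  have hzz : Real.arctan z ≤ z := arctan_le_self hz0.le
  have hy1 : 0 ≤ Real.pi / 2 - Real.arctan y := by linarith [Real.arctan_lt_pi_div_two y]
  have hz1 : 0 ≤ Real.arctan z := Real.arctan_nonneg.2 hz0.le
  rw [e1, abs_of_nonneg (by positivity)]
  have b1 : √x * y⁻¹ ≤ Real.exp (-T) := by
    have : y⁻¹ = √x * Real.exp (T - √R) := by
      rw [hy, inv_div, div_eq_mul_inv, ← Real.exp_neg, neg_sub]
    rw [this, ← mul_assoc, Real.mul_self_sqrt hx.le]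
    have hE : Real.exp (T - √R) ≤ Real.exp (-T) := Real.exp_le_exp.2 (by linarith)
    nlinarith [Real.exp_pos (T - √R)]
  have b2 : √x * z = Real.exp 1 * Real.exp (-T) := by
    rw [hz, mul_div_cancel₀ _ hsx.ne', ← Real.exp_add]; rfl
  have he := Real.exp_one_lt_d9
  have hE := Real.exp_pos (-T)
  have hp : 2 / Real.pi ≤ 2 / 3 := by gcongr
  have hp0 : 0 < 2 / Real.pi := by positivity
  calc 2 * √x / Real.pi * ((Real.pi / 2 - Real.arctan y) + Real.arctan z)
      = 2 / Real.pi * (√x * ((Real.pi / 2 - Real.arctan y) + Real.arctan z)) := by ring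
    _ ≤ 2 / 3 * (√x * (y⁻¹ + z)) := by gcongr
    _ ≤ 2 / 3 * (Real.exp (-T) + Real.exp 1 * Real.exp (-T)) := by
        rw [mul_add, b2]; gcongr
    _ ≤ 3 * Real.exp (-T) := by nlinarith

lemma norm_two_pi_I_mul_residues_le {T x : ℝ} (hx : 0 < x)
    (hL : 2 ≤ T + 1 / 2 * Real.log x) :
    ‖2 * Real.pi * I *
        (residue T (pole (T + 1 / 2 * Real.log x) 1) * delta (pole (T + 1 / 2 * Real.log x) 1)
          + residue T (pole (T + 1 / 2 * Real.log x) (-1))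
            * delta (pole (T + 1 / 2 * Real.log x) (-1)))‖ ≤ 8 * Real.exp (-T) := by
  have hpi := Real.pi_pos
  have hsx : 0 < √x := Real.sqrt_pos.2 hx
  have d1 := norm_delta_pole_le hL (Or.inl (rfl : (1 : ℝ) = 1))
  have d2 := norm_delta_pole_le hL (Or.inr (rfl : (-1 : ℝ) = -1))
  have r1 := norm_residue_pole (T := T) 1 hx (by linarith)
  have r2 := norm_residue_pole (T := T) (-1) hx (by linarith)
  have hexp : √x * Real.exp (-(T + 1 / 2 * Real.log x)) = Real.exp (-T) := by
    have : √x = Real.exp (Real.log x / 2) := by rw [Real.exp_half, Real.exp_log hx]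
    rw [this, ← Real.exp_add]; congr 1; ring
  set E := Real.exp (-(T + 1 / 2 * Real.log x))
  rw [norm_mul]
  have n1 : ‖(2 * Real.pi * I : ℂ)‖ = 2 * Real.pi := by simp [abs_of_pos hpi]
  rw [n1]
  calc 2 * Real.pi * ‖_ + _‖ ≤ 2 * Real.pi * (√x / Real.pi * (2 * E) + √x / Real.pi * (2 * E)) := by
        refine mul_le_mul_of_nonneg_left ((norm_add_le _ _).trans ?_) (by positivity)
        rw [norm_mul, norm_mul, r1, r2]
        gcongr
    _ = 8 * (√x * E) := by field_simp; ring
    _ = 8 * Real.exp (-T) := by rw [hexp]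

/-- The quadrature rule with nodes `h, 2h, …, N h` applied to `f(·, x)`, a rational function
of `x`. -/
noncomputable def quadrature (N : ℕ) (x : ℝ) : ℝ :=
  stepSize * ∑ k ∈ Finset.Icc 1 N, realIntegrand (truncation N) x (k * stepSize)

lemma abs_sqrt_sub_quadrature_le_of_contourBound (hbound : ContourBound) {N : ℕ} (hN : 1 ≤ N)
    {x : ℝ} (hx : Real.exp (4 - 2 * truncation N) ≤ x) (hx1 : x ≤ 1) :
    |√x - quadrature N x| ≤ 23 * Real.exp (-truncation N) := by
  have hx0 : 0 < x := (Real.exp_pos _).trans_le hx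
  have hL : 2 ≤ truncation N + 1 / 2 * Real.log x := by
    have := (Real.le_log_iff_exp_le hx0).2 hx
    linarith
  have hb := hbound N hN x ⟨hx, hx1⟩
  rw [rectIntegral_eq_quadrature_error hx0 hx1 hL] at hb
  have hr := norm_two_pi_I_mul_residues_le hx0 hL
  have hR : (1 : ℝ) ≤ 4 * truncation N ^ 2 + 1 := by nlinarith [sq_nonneg (truncation N)]
  have hsqrt : 2 * truncation N ≤ √(4 * truncation N ^ 2 + 1) :=
    Real.le_sqrt_of_sq_le (by nlinarith)
  have ht := abs_sqrt_sub_truncated_integral_le hx0 hx1 hsqrt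
  rw [integral_integrand _ hx0 hR] at hb
  set J := 2 * √x / Real.pi * (Real.arctan (Real.exp (√(4 * truncation N ^ 2 + 1) - truncation N)
    / √x) - Real.arctan (Real.exp (1 - truncation N) / √x))
  set ρ := 2 * Real.pi * I *
        (residue (truncation N) (pole (truncation N + 1 / 2 * Real.log x) 1)
            * delta (pole (truncation N + 1 / 2 * Real.log x) 1)
          + residue (truncation N) (pole (truncation N + 1 / 2 * Real.log x) (-1))
            * delta (pole (truncation N + 1 / 2 * Real.log x) (-1)))
  change ‖(J : ℂ) - (quadrature N x : ℂ) + ρ‖ < _ at hb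
  have h1 : |J - quadrature N x| ≤ 20 * Real.exp (-truncation N) := by
    have e : ((J - quadrature N x : ℝ) : ℂ) = ((J : ℂ) - (quadrature N x : ℂ) + ρ) - ρ := by
      push_cast; ring
    rw [← Real.norm_eq_abs, ← Complex.norm_real, e]
    exact (norm_sub_le _ _).trans (by linarith)
  calc |√x - quadrature N x| = |(√x - J) + (J - quadrature N x)| := by congr 1; ring
    _ ≤ |√x - J| + |J - quadrature N x| := abs_add_le _ _
    _ ≤ 23 * Real.exp (-truncation N) := by linarith

lemma sum_inv_sq_le_two (N : ℕ) : ∑ k ∈ Finset.Icc 1 N, 1 / (k : ℝ) ^ 2 ≤ 2 := by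
  have h : ∀ n : ℕ, ∑ k ∈ Finset.Icc 1 (n + 1), 1 / (k : ℝ) ^ 2 ≤ 2 - 1 / ((n : ℝ) + 1) := by
    intro n
    induction n with
    | zero => norm_num
    | succ n ih =>
      rw [Finset.sum_Icc_succ_top (by omega)]
      refine (add_le_add_left ih _).trans ?_
      push_cast
      have : 1 / ((n : ℝ) + 1 + 1) ^ 2 ≤ 1 / ((n : ℝ) + 1) - 1 / ((n : ℝ) + 1 + 1) := by
        rw [div_sub_div _ _ (by positivity) (by positivity), div_le_div_iff₀ (by positivity)
          (by positivity)]
        nlinarith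
      linarith
  rcases N with _ | n
  · simp
  · refine (h n).trans ?_
    have : 0 ≤ 1 / ((n : ℝ) + 1) := by positivity
    linarith

lemma realIntegrand_nonneg (T s : ℝ) {x : ℝ} (hx : 0 ≤ x) : 0 ≤ realIntegrand T x s := by
  have := Real.pi_pos
  unfold realIntegrand; positivity

/-- Near `x = 0` the rule is itself `O(e^{-T})`. -/
lemma quadrature_le {N : ℕ} {x : ℝ} (hx : 0 ≤ x) (hx4 : x ≤ Real.exp (4 - 2 * truncation N)) :
    quadrature N x ≤ 2 * Real.exp 4 * Real.exp (-truncation N) := by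
  have hpi := Real.pi_gt_three
  have hh := stepSize_pos
  have hh18 : 18 < stepSize := by unfold stepSize; nlinarith
  set T := truncation N with hT
  have hterm : ∀ k ∈ Finset.Icc 1 N, stepSize * realIntegrand T x (k * stepSize) ≤
      Real.exp 4 * Real.exp (-T) * (1 / (k : ℝ) ^ 2) := by
    intro k hk
    have hk0 : (0 : ℝ) < k := by exact_mod_cast (Finset.mem_Icc.1 hk).1
    set t := √(k * stepSize) with ht
    have ht0 : 0 < t := Real.sqrt_pos.2 (by positivity)
    have ht2 : t ^ 2 = k * stepSize := Real.sq_sqrt (by positivity)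
    -- `e^s / (e^{2s} + x) ≤ e^{-s}`
    have hfrac : Real.exp (t - T) / (Real.exp (2 * (t - T)) + x) ≤ Real.exp (T - t) := by
      rw [div_le_iff₀ (by positivity), mul_add, ← Real.exp_add,
        show T - t + 2 * (t - T) = t - T by ring]
      have : 0 ≤ Real.exp (T - t) * x := by positivity
      linarith
    have hcube : t ^ 3 / 6 ≤ Real.exp t := by
      simpa [Nat.factorial] using Real.pow_div_factorial_le_exp t ht0.le 3
    have hexp : x * Real.exp (T - t) ≤ Real.exp 4 * Real.exp (-T) * (6 / t ^ 3) := by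
      calc x * Real.exp (T - t) ≤ Real.exp (4 - 2 * T) * Real.exp (T - t) := by gcongr
        _ = Real.exp 4 * Real.exp (-T) * (1 / Real.exp t) := by
            rw [one_div, ← Real.exp_neg, ← Real.exp_add, ← Real.exp_add, ← Real.exp_add]
            congr 1; ring
        _ ≤ Real.exp 4 * Real.exp (-T) * (6 / t ^ 3) := by
            refine mul_le_mul_of_nonneg_left ?_ (by positivity)
            rw [div_le_div_iff₀ (Real.exp_pos t) (by positivity)]
            linarith
    calc stepSize * realIntegrand T x (k * stepSize)
        = stepSize / (Real.pi * t) *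
          (x * (Real.exp (t - T) / (Real.exp (2 * (t - T)) + x))) := by
          rw [realIntegrand, ← ht]; field_simp
      _ ≤ stepSize / (Real.pi * t) * (x * Real.exp (T - t)) := by gcongr
      _ ≤ stepSize / (Real.pi * t) * (Real.exp 4 * Real.exp (-T) * (6 / t ^ 3)) := by gcongr
      _ = Real.exp 4 * Real.exp (-T) * (6 * stepSize / (Real.pi * (t ^ 2) ^ 2)) := by
          field_simp
      _ = Real.exp 4 * Real.exp (-T) * (6 / (Real.pi * stepSize) * (1 / (k : ℝ) ^ 2)) := by
          rw [ht2]; field_simp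
      _ ≤ Real.exp 4 * Real.exp (-T) * (1 * (1 / (k : ℝ) ^ 2)) := by
          gcongr
          rw [div_le_one (by positivity)]
          nlinarith
      _ = _ := by rw [one_mul]
  rw [quadrature, Finset.mul_sum]
  refine (Finset.sum_le_sum hterm).trans ?_
  rw [← Finset.mul_sum]
  have hE : 0 ≤ Real.exp 4 * Real.exp (-T) := by positivity
  nlinarith [sum_inv_sq_le_two N]

theorem abs_sqrt_sub_quadrature_le (hbound : ContourBound) {N : ℕ} (hN : 1 ≤ N) {x : ℝ}
    (hx : x ∈ Icc (0 : ℝ) 1) :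
    |√x - quadrature N x| ≤ (23 + 2 * Real.exp 4) * Real.exp (-truncation N) := by
  have hE := Real.exp_pos (-truncation N)
  rcases le_total (Real.exp (4 - 2 * truncation N)) x with h | h
  · have := abs_sqrt_sub_quadrature_le_of_contourBound hbound hN h hx.2
    nlinarith [mul_pos (Real.exp_pos 4) hE]
  · have h1 := quadrature_le hx.1 h
    have h2 : 0 ≤ quadrature N x :=
      mul_nonneg stepSize_pos.le (Finset.sum_nonneg fun k _ => realIntegrand_nonneg _ _ hx.1)
    have h3 : √x ≤ Real.exp 4 * Real.exp (-truncation N) := by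
      rw [← Real.exp_add]
      refine Real.sqrt_le_iff.2 ⟨(Real.exp_pos _).le, h.trans ?_⟩
      rw [← Real.exp_nat_mul]
      exact Real.exp_le_exp.2 (by push_cast; linarith)
    have h4 := mul_pos (Real.exp_pos 4) hE
    rw [abs_le]
    constructor <;> nlinarith [Real.sqrt_nonneg x]

end LightningPoly

namespace LightningPoly

open Set

/-! ### From the quadrature rule to lightning + polynomial approximants -/

/-- For `p ≤ -1` the pole of `x / (x - p)` is at distance at least `3/2` from the centre of
`[0, 1]`, so the geometric series at `1/2` converges on `[0, 1]` with ratio at most `1/3`. -/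
lemma exists_polynomial_near_simple_fraction {p : ℝ} (hp : p ≤ -1) {n : ℕ} (hn : 1 ≤ n) :
    ∃ q ∈ Polynomial.degreeLT ℝ n, ∀ x ∈ Icc (0 : ℝ) 1,
      |x / (x - p) - q.eval x| ≤ (1 / 3) ^ n := by
  set d : ℝ := 1 / 2 - p with hd
  have hd0 : 3 / 2 ≤ d := by rw [hd]; linarith
  refine ⟨1 + ∑ j ∈ Finset.range n,
    (p / d ^ (j + 1)) • (Polynomial.C (1 / 2 : ℝ) - Polynomial.X) ^ j, ?_, ?_⟩
  · refine Submodule.add_mem _ ?_ (Submodule.sum_mem _ fun j hj => Submodule.smul_mem _ _ ?_)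
    · rw [Polynomial.mem_degreeLT, Polynomial.degree_one]
      exact_mod_cast hn
    · rw [Polynomial.mem_degreeLT]
      have h1 : (Polynomial.C (1 / 2 : ℝ) - Polynomial.X).degree ≤ 1 :=
        (Polynomial.degree_sub_le _ _).trans
          (max_le (Polynomial.degree_C_le.trans (by norm_num)) Polynomial.degree_X_le)
      refine ((Polynomial.degree_pow_le_of_le j h1)).trans_lt ?_
      rw [mul_one]
      exact_mod_cast Finset.mem_range.1 hj
  · intro x hx
    have hxp : 0 < x - p := by linarith [hx.1]
    have hd' : d ≠ 0 := by linarith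
    set ρ : ℝ := (1 / 2 - x) / d with hρ
    have hρ1 : |ρ| ≤ 1 / 3 := by
      rw [hρ, abs_div, abs_of_pos (by linarith : 0 < d), div_le_iff₀ (by linarith), abs_le]
      constructor <;> linarith [hx.1, hx.2]
    have hρd : ρ * d = 1 / 2 - x := div_mul_cancel₀ _ hd'
    have hxd : x - p = d * (1 - ρ) := by linear_combination hρd - hd
    have hρne : ρ ≠ 1 := fun h => by rw [h] at hρ1; norm_num at hρ1
    have hev : (1 + ∑ j ∈ Finset.range n,
        (p / d ^ (j + 1)) • (Polynomial.C (1 / 2 : ℝ) - Polynomial.X) ^ j : Polynomial ℝ).eval x =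
        1 + p / d * ∑ j ∈ Finset.range n, ρ ^ j := by
      simp only [Polynomial.eval_add, Polynomial.eval_one, Polynomial.eval_finsetSum,
        Polynomial.eval_smul, Polynomial.eval_pow, Polynomial.eval_sub, Polynomial.eval_C,
        Polynomial.eval_X, smul_eq_mul, Finset.mul_sum]
      congr 1
      refine Finset.sum_congr rfl fun j _ => ?_
      rw [hρ, div_pow, pow_succ]; field_simp
    have hdiff : x / (x - p) - (1 + p / d * ∑ j ∈ Finset.range n, ρ ^ j) =
        p / (x - p) * ρ ^ n := by
      have h1 : 1 - ρ ≠ 0 := sub_ne_zero.2 hρne.symm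
      have h2 : ρ - 1 ≠ 0 := sub_ne_zero.2 hρne
      have h3 : x = d * (1 - ρ) + p := by linarith
      rw [geom_sum_eq hρne, hxd]
      rw [h3]
      field_simp
      ring
    rw [hev, hdiff, abs_mul, abs_pow]
    have h1 : |p / (x - p)| ≤ 1 := by
      rw [abs_div, abs_of_pos hxp, div_le_one hxp, abs_of_neg (by linarith)]
      linarith [hx.1]
    calc |p / (x - p)| * |ρ| ^ n ≤ 1 * (1 / 3) ^ n := by gcongr
      _ = _ := one_mul _

/-- The coefficient of `x / (x - p_k)` in the quadrature rule with `4 N₁` nodes. -/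
noncomputable def weight (N₁ k : ℕ) : ℝ :=
  stepSize / (Real.pi * √(k * stepSize)) * Real.exp (√(k * stepSize) - truncation (4 * N₁))

lemma sqrt_mul_stepSize (k : ℕ) : √(k * stepSize) = √2 * Real.pi * √k := by
  rw [stepSize, show (k : ℝ) * (2 * Real.pi ^ 2) = 2 * Real.pi ^ 2 * k by ring,
    Real.sqrt_mul (by positivity), Real.sqrt_mul (by norm_num), Real.sqrt_sq Real.pi_pos.le]

lemma truncation_four_mul (N₁ : ℕ) : truncation (4 * N₁) = √2 * Real.pi * √N₁ := by
  rw [← sqrt_mul_stepSize, truncation]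
  congr 1; push_cast; ring

lemma weight_pos (N₁ : ℕ) {k : ℕ} (hk : 1 ≤ k) : 0 < weight N₁ k := by
  have h0 : (0 : ℝ) < k := by exact_mod_cast hk
  have := Real.pi_pos
  have := stepSize_pos
  have : 0 < √(k * stepSize) := Real.sqrt_pos.2 (by positivity)
  unfold weight; positivity

lemma weight_le {N₁ k : ℕ} (hk : k ∈ Finset.Icc 1 (4 * N₁)) :
    weight N₁ k ≤ 2 * Real.exp (truncation (4 * N₁)) := by
  have hpi := Real.pi_pos
  obtain ⟨hk1, hk4⟩ := Finset.mem_Icc.1 hk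
  have h1 : (1 : ℝ) ≤ √k := Real.one_le_sqrt.2 (by exact_mod_cast hk1)
  have h2 : √(k : ℝ) ≤ 2 * √N₁ := by
    rw [show (2 : ℝ) = √4 by rw [show (4 : ℝ) = 2 ^ 2 by norm_num, Real.sqrt_sq (by norm_num)],
      ← Real.sqrt_mul (by norm_num)]
    exact Real.sqrt_le_sqrt (by exact_mod_cast hk4)
  have hs2 : √2 ^ 2 = (2 : ℝ) := Real.sq_sqrt (by norm_num)
  have hs0 : 0 < √2 := by positivity
  have hs1 : √2 ≤ 2 := by nlinarith
  rw [weight, sqrt_mul_stepSize, truncation_four_mul]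
  refine mul_le_mul ?_ (Real.exp_le_exp.2 ?_) (Real.exp_pos _).le (by norm_num)
  · rw [div_le_iff₀ (by positivity), stepSize]
    have : √2 * √2 ≤ 2 * (√2 * √k) := by nlinarith
    nlinarith [mul_pos hpi hpi]
  · have : √2 * Real.pi * √k ≤ √2 * Real.pi * (2 * √N₁) := by gcongr
    linarith

lemma taperedPole_one (N₁ k : ℕ) : taperedPole 1 (2 * √2 * Real.pi) N₁ k =
    -Real.exp (2 * (√(k * stepSize) - truncation (4 * N₁))) := by
  rw [taperedPole, sqrt_mul_stepSize, truncation_four_mul, neg_one_mul]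
  congr 2; ring

lemma taperedPole_neg {C : ℝ} (hC : 0 < C) (σ : ℝ) (N₁ k : ℕ) : taperedPole C σ N₁ k < 0 := by
  have := mul_pos hC (Real.exp_pos (-σ * (√(N₁ : ℝ) - √(k : ℝ))))
  rw [taperedPole]; linarith

lemma quadrature_four_mul (N₁ : ℕ) (x : ℝ) :
    quadrature (4 * N₁) x = ∑ k ∈ Finset.Icc 1 (4 * N₁),
      weight N₁ k * (x / (x - taperedPole 1 (2 * √2 * Real.pi) N₁ k)) := by
  rw [quadrature, Finset.mul_sum]
  refine Finset.sum_congr rfl fun k _ => ?_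
  rw [realIntegrand, weight, taperedPole_one, sub_neg_eq_add, add_comm x]
  ring

/-- The nodes beyond the `N₁`-th have poles in `(-∞, -1]`; their contribution is replaced by a
polynomial. The exact degree is forced by a perturbation of size `e^{-T}`. -/
lemma approximatesSqrt_one_of_contourBound (hbound : ContourBound) {N₁ N₂ : ℕ} (h1 : 1 ≤ N₁)
    (h2 : 3 * (√2 * Real.pi * √N₁) ≤ N₂) :
    ApproximatesSqrt 1 (2 * √2 * Real.pi) N₁ N₂
      ((40 + 2 * Real.exp 4) * Real.exp (-(√2 * Real.pi * √N₁))) := by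
  have hpi := Real.pi_gt_three
  set T := √2 * Real.pi * √N₁ with hT
  have hTt : truncation (4 * N₁) = T := truncation_four_mul N₁
  have hT0 : 0 < T := by
    have : (0 : ℝ) < N₁ := by exact_mod_cast h1
    positivity
  have hN2 : 1 ≤ N₂ := by
    have : (0 : ℝ) < N₂ := by linarith
    exact_mod_cast this
  set p : ℕ → ℝ := taperedPole 1 (2 * √2 * Real.pi) N₁ with hp
  have hp1 : ∀ k, N₁ < k → p k ≤ -1 := by
    intro k hk
    rw [hp, taperedPole_one, neg_le_neg_iff, sqrt_mul_stepSize, hTt, hT]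
    refine Real.one_le_exp (mul_nonneg (by norm_num) (sub_nonneg.2 ?_))
    have : √(N₁ : ℝ) ≤ √k := Real.sqrt_le_sqrt (by exact_mod_cast hk.le)
    gcongr
  have hpneg : ∀ k, p k < 0 := fun k => taperedPole_neg one_pos _ _ _
  have hq : ∀ k, ∃ q ∈ Polynomial.degreeLT ℝ N₂, N₁ < k → ∀ x ∈ Icc (0 : ℝ) 1,
      |x / (x - p k) - q.eval x| ≤ (1 / 3) ^ N₂ := fun k => by
    by_cases hk : N₁ < k
    · obtain ⟨q, hq, hx⟩ := exists_polynomial_near_simple_fraction (hp1 k hk) hN2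
      exact ⟨q, hq, fun _ => hx⟩
    · exact ⟨0, Submodule.zero_mem _, fun h => absurd h hk⟩
  choose q hqdeg hqerr using hq
  set ε := Real.exp (-T) with hε
  have hε0 : 0 < ε := Real.exp_pos _
  set b₀ : Polynomial ℝ := (∑ k ∈ Finset.Icc 1 N₁, weight N₁ k) • 1 +
    ∑ k ∈ Finset.Icc (N₁ + 1) (4 * N₁), weight N₁ k • q k with hb₀
  have hb₀deg : b₀.degree < N₂ := by
    rw [← Polynomial.mem_degreeLT]
    refine Submodule.add_mem _ (Submodule.smul_mem _ _ ?_)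
      (Submodule.sum_mem _ fun k _ => Submodule.smul_mem _ _ (hqdeg k))
    rw [Polynomial.mem_degreeLT, Polynomial.degree_one]
    exact_mod_cast hN2
  refine ⟨fun k => weight N₁ k * p k, b₀ + Polynomial.C ε * Polynomial.X ^ N₂, ?_, ?_, ?_⟩
  · intro k hk
    exact mul_ne_zero (weight_pos N₁ (Finset.mem_Icc.1 hk).1).ne' (hpneg k).ne
  · have hd := Polynomial.degree_C_mul_X_pow N₂ hε0.ne'
    apply Polynomial.natDegree_eq_of_degree_eq_some
    rw [Polynomial.degree_add_eq_right_of_degree_lt (by rwa [hd]), hd]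
  · intro x hx
    have hquad := abs_sqrt_sub_quadrature_le hbound (N := 4 * N₁) (by omega) hx
    rw [hTt, quadrature_four_mul, ← hp] at hquad
    have hsplit : ∑ k ∈ Finset.Icc 1 (4 * N₁), weight N₁ k * (x / (x - p k)) =
        ∑ k ∈ Finset.Icc 1 N₁, weight N₁ k * (x / (x - p k)) +
        ∑ k ∈ Finset.Icc (N₁ + 1) (4 * N₁), weight N₁ k * (x / (x - p k)) := by
      have hI : ∀ i j : ℕ, Finset.Icc (i + 1) j = Finset.Ioc i j := fun i j => by
        ext; simp only [Finset.mem_Icc, Finset.mem_Ioc]; omega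
      rw [← zero_add 1, hI, hI, hI]
      exact (Finset.sum_Ioc_consecutive _ (Nat.zero_le N₁) (by omega)).symm
    have hfirst : ∑ k ∈ Finset.Icc 1 N₁, weight N₁ k * (x / (x - p k)) =
        ∑ k ∈ Finset.Icc 1 N₁, weight N₁ k * p k / (x - p k) +
          ∑ k ∈ Finset.Icc 1 N₁, weight N₁ k := by
      rw [← Finset.sum_add_distrib]
      refine Finset.sum_congr rfl fun k _ => ?_
      have : x - p k ≠ 0 := by linarith [hx.1, hpneg k]
      field_simp
      ring
    set tail := ∑ k ∈ Finset.Icc (N₁ + 1) (4 * N₁), weight N₁ k * (x / (x - p k))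
    have hev : approximant 1 (2 * √2 * Real.pi) N₁ (fun k => weight N₁ k * p k)
        (b₀ + Polynomial.C ε * Polynomial.X ^ N₂) x =
        (∑ k ∈ Finset.Icc 1 (4 * N₁), weight N₁ k * (x / (x - p k))) +
        (∑ k ∈ Finset.Icc (N₁ + 1) (4 * N₁), weight N₁ k * (q k).eval x - tail) + ε * x ^ N₂ := by
      rw [hsplit, hfirst, approximant, ← hp, hb₀]
      simp only [Polynomial.eval_add, Polynomial.eval_smul, Polynomial.eval_one,
        Polynomial.eval_finsetSum, Polynomial.eval_mul, Polynomial.eval_C, Polynomial.eval_pow,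
        Polynomial.eval_X, smul_eq_mul]
      ring
    have htail : |∑ k ∈ Finset.Icc (N₁ + 1) (4 * N₁), weight N₁ k * (q k).eval x - tail| ≤
        16 * ε := by
      have hterm : ∀ k ∈ Finset.Icc (N₁ + 1) (4 * N₁),
          |weight N₁ k * (q k).eval x - weight N₁ k * (x / (x - p k))| ≤
            2 * Real.exp T * Real.exp (-(3 * T)) := by
        intro k hk
        obtain ⟨hk1, hk2⟩ := Finset.mem_Icc.1 hk
        have hw := weight_le (N₁ := N₁) (k := k) (Finset.mem_Icc.2 ⟨by omega, hk2⟩)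
        rw [hTt] at hw
        rw [← mul_sub, abs_mul, abs_of_pos (weight_pos N₁ (by omega)), abs_sub_comm]
        have h3 : ((1 : ℝ) / 3) ^ N₂ ≤ Real.exp (-(3 * T)) := by
          have he : (1 : ℝ) / 3 ≤ Real.exp (-1) := by
            rw [Real.exp_neg, ← one_div]
            have := Real.exp_one_lt_d9
            exact one_div_le_one_div_of_le (Real.exp_pos 1) (by linarith)
          calc ((1 : ℝ) / 3) ^ N₂ ≤ Real.exp (-1) ^ N₂ := by gcongr
            _ = Real.exp (N₂ * (-1)) := (Real.exp_nat_mul _ _).symm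
            _ ≤ Real.exp (-(3 * T)) := Real.exp_le_exp.2 (by linarith)
        exact mul_le_mul hw ((hqerr k (by omega) x hx).trans h3) (abs_nonneg _) (by positivity)
      rw [← Finset.sum_sub_distrib]
      refine (Finset.abs_sum_le_sum_abs _ _).trans ((Finset.sum_le_sum hterm).trans ?_)
      rw [Finset.sum_const, nsmul_eq_mul, Nat.card_Icc]
      have hcard : ((4 * N₁ + 1 - (N₁ + 1) : ℕ) : ℝ) ≤ 8 * Real.exp T := by
        have e1 : ((4 * N₁ + 1 - (N₁ + 1) : ℕ) : ℝ) = 3 * N₁ := by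
          rw [show 4 * N₁ + 1 - (N₁ + 1) = 3 * N₁ by omega]; push_cast; ring
        have e2 : T ^ 2 / 2 ≤ Real.exp T := by
          simpa [Nat.factorial] using Real.pow_div_factorial_le_exp T hT0.le 2
        have e3 : T ^ 2 = 2 * Real.pi ^ 2 * N₁ := by
          rw [hT, mul_pow, mul_pow, Real.sq_sqrt (by norm_num), Real.sq_sqrt (Nat.cast_nonneg _)]
        have e4 : (0 : ℝ) ≤ N₁ := Nat.cast_nonneg _
        have e5 : 9 ≤ Real.pi ^ 2 := by nlinarith
        rw [e1]; nlinarith [mul_le_mul_of_nonneg_right e5 e4]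
      have hexp : Real.exp T * (Real.exp T * Real.exp (-(3 * T))) = ε := by
        rw [hε, ← Real.exp_add, ← Real.exp_add]; congr 1; ring
      calc _ ≤ 8 * Real.exp T * (2 * Real.exp T * Real.exp (-(3 * T))) := by gcongr
        _ = 16 * (Real.exp T * (Real.exp T * Real.exp (-(3 * T)))) := by ring
        _ = 16 * ε := by rw [hexp]
    have hlast : |ε * x ^ N₂| ≤ ε := by
      rw [abs_of_nonneg (mul_nonneg hε0.le (pow_nonneg hx.1 _))]
      exact mul_le_of_le_one_right hε0.le (pow_le_one₀ hx.1 hx.2)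
    rw [hev]
    set Q := ∑ k ∈ Finset.Icc 1 (4 * N₁), weight N₁ k * (x / (x - p k))
    rw [abs_le] at hquad htail hlast ⊢
    constructor <;> linarith [hquad.1, hquad.2, htail.1, htail.2, hlast.1, hlast.2]

/-- The substitution `x ↦ x / C`, which maps `[0, 1]` into itself, together with
`√x = √C √(x / C)` moves the poles from `[-1, 0)` to `[-C, 0)`. -/
lemma ApproximatesSqrt.rescale {C σ ε : ℝ} {N₁ N₂ : ℕ} (hC : 1 ≤ C)
    (h : ApproximatesSqrt 1 σ N₁ N₂ ε) : ApproximatesSqrt C σ N₁ N₂ (√C * ε) := by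
  obtain ⟨a, b, ha, hb, he⟩ := h
  have hC0 : 0 < C := by linarith
  have hs0 : 0 < √C := Real.sqrt_pos.2 hC0
  refine ⟨fun j => √C * C * a j,
    Polynomial.C (√C) * b.comp (Polynomial.C C⁻¹ * Polynomial.X), ?_, ?_, ?_⟩
  · intro j hj
    exact mul_ne_zero (mul_pos hs0 hC0).ne' (ha j hj)
  · rw [Polynomial.natDegree_C_mul hs0.ne', Polynomial.natDegree_comp,
      Polynomial.natDegree_C_mul_X _ (inv_ne_zero hC0.ne'), mul_one, hb]
  · intro x hx
    have hxC : x / C ∈ Icc (0 : ℝ) 1 :=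
      ⟨div_nonneg hx.1 hC0.le, (div_le_one hC0).2 (hx.2.trans hC)⟩
    have hpole : ∀ j, taperedPole C σ N₁ j = C * taperedPole 1 σ N₁ j := fun j => by
      simp only [taperedPole]; ring
    have heq : approximant C σ N₁ (fun j => √C * C * a j)
        (Polynomial.C (√C) * b.comp (Polynomial.C C⁻¹ * Polynomial.X)) x =
        √C * approximant 1 σ N₁ a b (x / C) := by
      simp only [approximant, hpole, mul_add, Finset.mul_sum]
      congr 1
      · refine Finset.sum_congr rfl fun j _ => ?_
        have h1 : x / C - taperedPole 1 σ N₁ j ≠ 0 := by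
          linarith [hxC.1, taperedPole_neg one_pos σ N₁ j]
        have h2 : x - C * taperedPole 1 σ N₁ j = C * (x / C - taperedPole 1 σ N₁ j) := by
          field_simp
        rw [h2]; field_simp
      · simp [Polynomial.eval_comp, div_eq_inv_mul]
    have hsq : √x = √C * √(x / C) := by
      rw [← Real.sqrt_mul hC0.le, mul_div_cancel₀ _ hC0.ne']
    rw [heq, hsq, ← mul_sub, abs_mul, abs_of_pos hs0]
    exact mul_le_mul_of_nonneg_left (he _ hxC) hs0.le

lemma ApproximatesSqrt.mono {C σ ε ε' : ℝ} {N₁ N₂ : ℕ} (h : ApproximatesSqrt C σ N₁ N₂ ε)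
    (hε : ε ≤ ε') : ApproximatesSqrt C σ N₁ N₂ ε' := by
  obtain ⟨a, b, ha, hb, he⟩ := h
  exact ⟨a, b, ha, hb, fun x hx => (he x hx).trans hε⟩

/-- A crude approximant with vanishing polynomial part, for the finitely many small degrees. -/
lemma approximatesSqrt_two {C σ : ℝ} (hC : 0 < C) {N : ℕ} (hN : 1 ≤ N) :
    ApproximatesSqrt C σ N 0 2 := by
  have hN0 : (0 : ℝ) < N := by exact_mod_cast hN
  refine ⟨fun j => taperedPole C σ N j / N, 0, ?_, by simp, ?_⟩
  · intro j _
    exact div_ne_zero (taperedPole_neg hC σ N j).ne hN0.ne'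
  · intro x hx
    have hterm : ∀ j ∈ Finset.Icc 1 N,
        |taperedPole C σ N j / N / (x - taperedPole C σ N j)| ≤ 1 / N := by
      intro j _
      have hp := taperedPole_neg hC σ N j
      have hxp : 0 < x - taperedPole C σ N j := by linarith [hx.1]
      rw [abs_div, abs_div, abs_of_pos hxp, abs_of_pos hN0, abs_of_neg hp,
        div_right_comm]
      gcongr
      rw [div_le_one hxp]
      linarith [hx.1]
    have hsum := (Finset.abs_sum_le_sum_abs _ _).trans (Finset.sum_le_sum hterm)
    rw [Finset.sum_const, Nat.card_Icc, nsmul_eq_mul, Nat.add_sub_cancel,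
      mul_one_div_cancel hN0.ne'] at hsum
    have hs0 := Real.sqrt_nonneg x
    have hs1 : √x ≤ 1 := Real.sqrt_le_one.2 hx.2
    rw [approximant, Polynomial.eval_zero, add_zero]
    rw [abs_le] at hsum ⊢
    constructor <;> linarith [hsum.1, hsum.2]

/-- Adding `O(√N₁)` to the degree changes `e^{-π√(2 N₁)}` by at most a constant factor, because
`√(N₁ + N₂) ≤ √N₁ + 15`. -/
lemma exp_neg_sqrt_le_of_le_sqrt {N₁ N₂ : ℕ} (h : (N₂ : ℝ) ≤ 30 * √N₁) :
    Real.exp (-(√2 * Real.pi * √N₁)) ≤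
      Real.exp 120 * Real.exp (-Real.pi * √(2 * ((N₁ + N₂ : ℕ) : ℝ))) := by
  rw [← Real.exp_add, Real.exp_le_exp, Real.sqrt_mul (by norm_num)]
  have hsq : √(N₁ : ℝ) ^ 2 = N₁ := Real.sq_sqrt (Nat.cast_nonneg _)
  have hs : √((N₁ + N₂ : ℕ) : ℝ) ≤ √N₁ + 15 := by
    refine Real.sqrt_le_iff.2 ⟨by positivity, ?_⟩
    push_cast
    nlinarith
  have h2 : √2 * Real.pi ≤ 8 := by
    have : √2 ≤ (2 : ℝ) := Real.sqrt_le_iff.2 ⟨by norm_num, by norm_num⟩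
    nlinarith [Real.pi_le_four, Real.pi_pos, Real.sqrt_nonneg 2]
  have h3 : 0 ≤ √2 * Real.pi := by have := Real.pi_pos; positivity
  nlinarith [mul_le_mul_of_nonneg_left hs h3]

end LightningPoly

/-! ### Choice of the degrees -/

theorem mainTheorem1 (hbound : LightningPoly.ContourBound) (C : ℝ) (hC : 1 ≤ C) :
    ∃ M K : ℝ,
      (∀ N₁ : ℕ, 1 ≤ N₁ → ∃ N₂ : ℕ, (N₂ : ℝ) ≤ M * √(N₁ : ℝ) ∧
        LightningPoly.ApproximatesSqrt C (2 * √2 * Real.pi) N₁ N₂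
          (K * Real.exp (-Real.pi * √(2 * ((N₁ + N₂ : ℕ) : ℝ))))) ∧
      (∀ N : ℕ, 1 ≤ N → ∃ N₁ N₂ : ℕ, 1 ≤ N₁ ∧ N₁ + N₂ = N ∧ (N₂ : ℝ) ≤ M * √(N₁ : ℝ) ∧
        LightningPoly.ApproximatesSqrt C (2 * √2 * Real.pi) N₁ N₂
          (K * Real.exp (-Real.pi * √(2 * (N : ℝ))))) := by
  have hpi := Real.pi_pos
  have hC0 : 0 < √C := Real.sqrt_pos.2 (by linarith)
  set K₀ : ℝ := √C * (40 + 2 * Real.exp 4) with hK₀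
  have hK₀0 : 0 ≤ K₀ := by positivity
  have core : ∀ N₁ N₂ : ℕ, 1 ≤ N₁ → 3 * (√2 * Real.pi * √N₁) ≤ N₂ → (N₂ : ℝ) ≤ 30 * √N₁ →
      LightningPoly.ApproximatesSqrt C (2 * √2 * Real.pi) N₁ N₂
        ((K₀ + 2) * Real.exp 120 * Real.exp (-Real.pi * √(2 * ((N₁ + N₂ : ℕ) : ℝ)))) := by
    intro N₁ N₂ h1 h2 h3
    refine ((LightningPoly.approximatesSqrt_one_of_contourBound hbound h1 h2).rescale hC).mono ?_
    calc √C * ((40 + 2 * Real.exp 4) * Real.exp (-(√2 * Real.pi * √N₁)))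
        = K₀ * Real.exp (-(√2 * Real.pi * √N₁)) := by rw [hK₀]; ring
      _ ≤ (K₀ + 2) * (Real.exp 120 * Real.exp (-Real.pi * √(2 * ((N₁ + N₂ : ℕ) : ℝ)))) :=
          mul_le_mul (by linarith) (LightningPoly.exp_neg_sqrt_le_of_le_sqrt h3)
            (Real.exp_pos _).le (by positivity)
      _ = _ := by ring
  -- `3π√2 < 14`, so that `⌈3π√(2n)⌉ ≤ 15√n`
  have hc : 3 * (√2 * Real.pi) ≤ 14 := by
    have h2 : √2 ≤ (1.45 : ℝ) := Real.sqrt_le_iff.2 ⟨by norm_num, by norm_num⟩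
    nlinarith [Real.pi_lt_d2, Real.sqrt_nonneg 2]
  have hceil : ∀ n : ℕ, 1 ≤ n → (⌈3 * (√2 * Real.pi * √n)⌉₊ : ℝ) ≤ 15 * √n := by
    intro n hn
    have hs : (1 : ℝ) ≤ √n := Real.one_le_sqrt.2 (by exact_mod_cast hn)
    have := Nat.ceil_lt_add_one (a := 3 * (√2 * Real.pi * √n)) (by positivity)
    nlinarith
  refine ⟨30, (K₀ + 2) * Real.exp 120, fun N₁ h1 => ?_, fun N hN => ?_⟩
  · have h2 : (⌈3 * (√2 * Real.pi * √N₁)⌉₊ : ℝ) ≤ 30 * √N₁ :=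
      (hceil N₁ h1).trans (by nlinarith [Real.sqrt_nonneg (N₁ : ℝ)])
    exact ⟨⌈3 * (√2 * Real.pi * √N₁)⌉₊, h2, core _ _ h1 (Nat.le_ceil _) h2⟩
  · rcases lt_or_ge N 400 with hsmall | hlarge
    · refine ⟨N, 0, hN, rfl, by simp,
        (LightningPoly.approximatesSqrt_two (by linarith) hN).mono ?_⟩
      have hsq : √(2 * (N : ℝ)) ≤ 30 := by
        refine Real.sqrt_le_iff.2 ⟨by norm_num, ?_⟩
        have : (N : ℝ) < 400 := by exact_mod_cast hsmall
        linarith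
      have he : 1 ≤ Real.exp 120 * Real.exp (-Real.pi * √(2 * (N : ℝ))) := by
        rw [← Real.exp_add]
        refine Real.one_le_exp ?_
        nlinarith [Real.pi_le_four, Real.sqrt_nonneg (2 * (N : ℝ))]
      rw [mul_assoc]
      nlinarith
    · set N₂ := ⌈3 * (√2 * Real.pi * √N)⌉₊ with hN₂
      have hb := hceil N hN
      have hsq : √(N : ℝ) ^ 2 = N := Real.sq_sqrt (Nat.cast_nonneg _)
      have hs20 : (20 : ℝ) ≤ √N := Real.le_sqrt_of_sq_le (by
        have : (400 : ℝ) ≤ N := by exact_mod_cast hlarge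
        linarith)
      -- `15√N ≤ 3N/4` leaves at least `N/4` finite poles
      have h34 : (N₂ : ℝ) ≤ 3 / 4 * N := by nlinarith
      have hle : N₂ ≤ N := by
        have : (N₂ : ℝ) ≤ N := by linarith [Nat.cast_nonneg (α := ℝ) N]
        exact_mod_cast this
      have hcast : ((N - N₂ : ℕ) : ℝ) = N - N₂ := Nat.cast_sub hle
      have hquarter : (N : ℝ) / 4 ≤ (N - N₂ : ℕ) := by rw [hcast]; linarith
      have hsqrt : √(N : ℝ) ≤ 2 * √((N - N₂ : ℕ) : ℝ) := by
        rw [← abs_of_nonneg (Real.sqrt_nonneg (N : ℝ))]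
        refine abs_le_of_sq_le_sq ?_ (by positivity)
        rw [hsq, mul_pow, Real.sq_sqrt (Nat.cast_nonneg _)]
        linarith
      have hone : 1 ≤ N - N₂ := by
        have : (0 : ℝ) < (N - N₂ : ℕ) := by nlinarith
        exact_mod_cast this
      have h30 : (N₂ : ℝ) ≤ 30 * √((N - N₂ : ℕ) : ℝ) := by linarith
      have hlow : 3 * (√2 * Real.pi * √((N - N₂ : ℕ) : ℝ)) ≤ N₂ := by
        refine le_trans ?_ (Nat.le_ceil _)
        have : √((N - N₂ : ℕ) : ℝ) ≤ √N := Real.sqrt_le_sqrt (by exact_mod_cast Nat.sub_le N N₂)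
        gcongr
      have h := core (N - N₂) N₂ hone hlow h30
      rw [Nat.sub_add_cancel hle] at h
      exact ⟨N - N₂, N₂, hone, Nat.sub_add_cancel hle, h30, h⟩
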